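/- Let $\Omega\subset\mathbb R^2$ be a bounded polygonal Lipschitz domain with a conforming triangulation $\mathcal T_h$ into finitely many closed triangles, and let $\mathcal E_h$ be the set of all its (interior and boundary) edges. For every edge $e$ fix an adjacent triangle $K_+$, the unit normal $\boldsymbol n_e$ pointing out of $K_+$, and a unit tangent $\boldsymbol\tau_e$; for an interior edge let $K_-$ be the other adjacent triangle. The jump of a piecewise smooth $\varphi$ is $[\![\varphi]\!]_e=\varphi|_{K_+}-\varphi|_{K_-}$ on an interior edge and $[\![\varphi]\!]_e=\varphi|_{K_+}$ on a boundary edge. Write $\partial_n v=\nabla v\cdot\boldsymbol n_e$, $\partial_\tau v=\nabla v\cdot\boldsymbol\tau_e$, and for a matrix field $M$ put $M_{nn}=\boldsymbol n_e^TM\boldsymbol n_e$, $M_{n\tau}=\boldsymbol\tau_e^TM\boldsymbol n_e$; $\operatorname{div}M$ is the row-wise divergence, $D^2_{nn}v=(D^2v)_{nn}$ and $D^2_{n\tau}v=(D^2v)_{n\tau}$. Let $H^{-2}(\Omega)$ be the dual of $H^2_0(\Omega)$, and for $\sigma\in[L^2(\Omega)]^{2\times2}_{\rm sym}$ let $\operatorname{div}\operatorname{div}\sigma\in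 H^{-2}(\Omega)$ be given by $\langle\operatorname{div}\operatorname{div}\sigma,w\rangle=\int_\Omega\sigma:D^2w\,dx$. Let $f\in H^{-2}(\Omega)$, $\tilde f\in L^2(\Omega)$, $Q(v)=\int_\Omega\tilde f v\,dx$, and let $u,\tilde u\in H^2_0(\Omega)$ satisfy $$(D^2u,D^2v)=\langle f,v\rangle,\qquad (D^2\tilde u,D^2v)=(\tilde f,v)\qquad\text{for all } v\in H^2_0(\Omega).$$ Let $u_h,\tilde u_h\in L^2(\Omega)$ be arbitrary piecewise polynomials of degree at most $k$ on $\mathcal T_h$, let $s_h,\tilde s_h\in H^2_0(\Omega)\cap C^1(\bar\Omega)$, and let $\sigma_h^{\rm eq},\tilde\sigma_h^{\rm eq}\in[L^2(\Omega)]^{2\times2}_{\rm sym}$ be equilibrated moment tensors, i.e. $\operatorname{div}\operatorname{div}\sigma_h^{\rm eq}=f_h$ and $\operatorname{div}\operatorname{div}\tilde\sigma_h^{\rm eq}=\tilde f_h$ for some $f_h,\tilde f_h\in H^{-2}(\Omega)$. Assume that $\tilde u$ and $\tilde\sigma_h^{\rm eq}$ are regular enough for the edge integrals below to make sense: $M=D^2\tilde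 u$ on $\Omega$, and $M=\tilde\sigma_h^{\rm eq}$ on each triangle, have $\operatorname{div}M$ and $\operatorname{div}\operatorname{div}M$ in $L^1$, and on the edges $e$ of $\mathcal T_h$ (of the triangle) $M\boldsymbol n_e$ has traces in $L^1(e)$ and $\operatorname{div}M\cdot\boldsymbol n_e$ has traces in the $L^1$ space on $e$ with weight $|[\![u_h]\!]_e|$. Here traces are limits of restrictions: each row $q$ of $M$ (and $q=\operatorname{div}M$) is a limit of fields $\Phi_m\in C^\infty(\mathbb R^2)^2$ with $\Phi_m\to q$ and $\operatorname{div}\Phi_m\to\operatorname{div}q$ in $L^1$ on $\Omega$ (on the triangle), such that $\Phi_m\cdot\boldsymbol n_e$ converges on every edge $e$ in the respective $L^1$ space to the trace. (This holds, for instance, if $\tilde u\in W^{4,1}(\Omega)$ and $\tilde\sigma_h^{\rm eq}$ is piecewise polynomial.) If the traces of $\tilde\sigma_h^{\rm eq}$ from the two sides of an interior edge differ, its value on $e$ is any fixed combination $(1-w_e)\,\cdot|_{K_+}+w_e\,\cdot|_{K_-}$, $w_e\in\mathbb R$, the same one throughout. Then $$Q(u)-Q(u_h)=\eta_h+\mathcal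 R_h,$$ where $$\begin{aligned}\eta_h={}&\langle f,\tilde s_h\rangle-\sum_{K\in\mathcal T_h}\int_K\sigma_h^{\rm eq}:D^2\tilde s_h\,dx+\sum_{K\in\mathcal T_h}\int_K(\sigma_h^{\rm eq}-D^2u_h):\tilde\sigma_h^{\rm eq}\,dx\\&+\sum_{e\in\mathcal E_h}\int_e[\![\partial_\tau u_h]\!]_e\,\tilde\sigma^{\rm eq}_{h,n\tau}\,ds+\sum_{e\in\mathcal E_h}\int_e[\![\partial_nu_h]\!]_e\,\tilde\sigma^{\rm eq}_{h,nn}\,ds-\sum_{e\in\mathcal E_h}\int_e[\![u_h]\!]_e\operatorname{div}\tilde\sigma_h^{\rm eq}\cdot\boldsymbol n_e\,ds\end{aligned}$$ and $$\begin{aligned}\mathcal R_h={}&\langle f-\operatorname{div}\operatorname{div}\sigma_h^{\rm eq},\tilde u-\tilde s_h\rangle+\sum_{K\in\mathcal T_h}\int_K(\sigma_h^{\rm eq}-D^2u_h):(D^2\tilde u-\tilde\sigma_h^{\rm eq})\,dx\\&+\sum_{e\in\mathcal E_h}\int_e[\![\partial_\tau u_h]\!]_e(D^2_{n\tau}\tilde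 u-\tilde\sigma^{\rm eq}_{h,n\tau})\,ds+\sum_{e\in\mathcal E_h}\int_e[\![\partial_nu_h]\!]_e(D^2_{nn}\tilde u-\tilde\sigma^{\rm eq}_{h,nn})\,ds\\&-\sum_{e\in\mathcal E_h}\int_e[\![u_h]\!]_e\big(\operatorname{div}(D^2\tilde u)-\operatorname{div}\tilde\sigma_h^{\rm eq}\big)\cdot\boldsymbol n_e\,ds.\end{aligned}$$ -/

import Mathlib

open MeasureTheory Filter Topology
open scoped ContDiff

noncomputable section

namespace GoalBiharmonic

/-- The Euclidean plane. -/
abbrev Plane : Type := EuclideanSpace ℝ (Fin 2)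

/-- The partial derivative `∂φ/∂xᵢ`. -/
def pd (i : Fin 2) (φ : Plane → ℝ) (x : Plane) : ℝ :=
  fderiv ℝ φ x (EuclideanSpace.single i 1)

/-! ### The spaces `L²(Ω)`, `H²₀(Ω)`, `H⁻²(Ω)` -/

/-- `L²(Ω)`. -/
abbrev L2 (Ω : Set Plane) : Type := Lp ℝ 2 (volume.restrict Ω)

/-- `2 × 2` matrix valued functions with entries in `L²(Ω)`. -/
abbrev Tensor (Ω : Set Plane) : Type := Fin 2 → Fin 2 → L2 Ω

/-- Triples `(v, ∇v, D²v)` with entries in `L²(Ω)`; the (maximum of the) `L²` norms of the entries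
is a norm equivalent to the `H²(Ω)` norm. -/
abbrev Jet (Ω : Set Plane) : Type := L2 Ω × (Fin 2 → L2 Ω) × Tensor Ω

/-- `x` is the triple `(φ, ∇φ, D²φ)` of a function `φ ∈ C_c^∞(Ω)`. -/
def IsTestJet (Ω : Set Plane) (x : Jet Ω) : Prop :=
  ∃ φ : Plane → ℝ, ContDiff ℝ ∞ φ ∧ HasCompactSupport φ ∧ tsupport φ ⊆ Ω ∧
    x.1 =ᵐ[volume.restrict Ω] φ ∧
    (∀ i, x.2.1 i =ᵐ[volume.restrict Ω] pd i φ) ∧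
    ∀ i j, x.2.2 i j =ᵐ[volume.restrict Ω] pd i (pd j φ)

/-- `H²₀(Ω)`: the closure of `C_c^∞(Ω)` in the `H²(Ω)` norm, each function being stored together
with its first and second weak derivatives. (The triples of test functions already form a linear
space, so that the span adds nothing.) -/
def H20 (Ω : Set Plane) : Submodule ℝ (Jet Ω) :=
  (Submodule.span ℝ {x : Jet Ω | IsTestJet Ω x}).topologicalClosure

/-- `H⁻²(Ω)`, the dual space of `H²₀(Ω)`. -/
abbrev HMinus2 (Ω : Set Plane) : Type := H20 Ω →L[ℝ] ℝ

/-- The `L²(Ω)` function underlying `v ∈ H²₀(Ω)`. -/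
def fnOf {Ω : Set Plane} (v : H20 Ω) : L2 Ω := (v : Jet Ω).1

/-- The matrix `D²v` of second order weak derivatives of `v ∈ H²₀(Ω)`. -/
def D2 {Ω : Set Plane} (v : H20 Ω) : Tensor Ω := (v : Jet Ω).2.2

/-- `∫_A p : q dx`. -/
def tensorIntegral (A : Set Plane) (p q : Fin 2 → Fin 2 → Plane → ℝ) : ℝ :=
  ∫ x in A, ∑ i, ∑ j, p i j x * q i j x

/-- The functions that represent the entries of an `L²` tensor. -/
def Tensor.fn {Ω : Set Plane} (σ : Tensor Ω) : Fin 2 → Fin 2 → Plane → ℝ := fun i j x => σ i j x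

/-- `v ↦ D²v` in the entry `(i, j)`, as a continuous linear map. -/
def hessCLM (Ω : Set Plane) (i j : Fin 2) : H20 Ω →L[ℝ] L2 Ω :=
  (ContinuousLinearMap.proj (R := ℝ) (φ := fun _ : Fin 2 => L2 Ω) j).comp
    ((ContinuousLinearMap.proj (R := ℝ) (φ := fun _ : Fin 2 => Fin 2 → L2 Ω) i).comp
      ((ContinuousLinearMap.snd ℝ (Fin 2 → L2 Ω) (Tensor Ω)).comp
        ((ContinuousLinearMap.snd ℝ (L2 Ω) ((Fin 2 → L2 Ω) × Tensor Ω)).comp (H20 Ω).subtypeL)))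

/-- The distribution `div div σ ∈ H⁻²(Ω)`, given by `⟨div div σ, w⟩ = ∫_Ω σ : D²w dx`
(see `divDiv_apply`). -/
def divDiv {Ω : Set Plane} (σ : Tensor Ω) : HMinus2 Ω :=
  ∑ i, ∑ j, (innerSL ℝ (σ i j)).comp (hessCLM Ω i j)

theorem divDiv_apply {Ω : Set Plane} (σ : Tensor Ω) (w : H20 Ω) :
    divDiv σ w = tensorIntegral Ω σ.fn (D2 w).fn := by
  have hint : ∀ i j, Integrable (fun x => σ i j x * D2 w i j x) (volume.restrict Ω) := by
    intro i j
    have h := L2.integrable_inner (𝕜 := ℝ) (σ i j) (D2 w i j)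
    refine h.congr (Eventually.of_forall fun x => ?_)
    simp [mul_comm]
  have h : divDiv σ w = ∑ i, ∑ j, inner ℝ (σ i j) (D2 w i j) := by
    simp [divDiv, hessCLM, D2]
  rw [h]
  simp only [tensorIntegral, Tensor.fn]
  rw [integral_finsetSum _ fun i _ => integrable_finsetSum _ fun j _ => hint i j]
  refine Finset.sum_congr rfl fun i _ => ?_
  rw [integral_finsetSum _ fun j _ => hint i j]
  refine Finset.sum_congr rfl fun j _ => ?_
  rw [L2.inner_def]
  refine integral_congr_ae (Eventually.of_forall fun x => ?_)
  simp [mul_comm]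

/-! ### The primal problem, the goal functional, the dual problem -/

/-- `u ∈ H²₀(Ω)` is the weak solution of `Δ²u = f`, `u = ∂u/∂ν = 0` on `∂Ω`, where `f ∈ H⁻²(Ω)`. -/
def IsPrimalSolution {Ω : Set Plane} (f : HMinus2 Ω) (u : H20 Ω) : Prop :=
  ∀ v : H20 Ω, tensorIntegral Ω (D2 u).fn (D2 v).fn = f v

/-- The goal functional `Q(v) = (f̃, v)` with weight `f̃ ∈ L²(Ω)`. -/
def goal {Ω : Set Plane} (ft v : L2 Ω) : ℝ := ∫ x in Ω, ft x * v x

/-- `ũ ∈ H²₀(Ω)` is the weak solution of the dual problem with load `f̃ ∈ L²(Ω)`. -/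
def IsDualSolution {Ω : Set Plane} (ft : L2 Ω) (ut : H20 Ω) : Prop :=
  ∀ v : H20 Ω, tensorIntegral Ω (D2 ut).fn (D2 v).fn = goal ft (fnOf v)

/-- `s ∈ H²₀(Ω) ∩ C¹(Ω̄)`. -/
def IsPotentialReconstruction {Ω : Set Plane} (s : H20 Ω) : Prop :=
  ∃ (g : Plane → ℝ) (g' : Plane → Plane →L[ℝ] ℝ),
    ContinuousOn g (closure Ω) ∧ ContinuousOn g' (closure Ω) ∧
    (∀ x ∈ Ω, HasFDerivAt g (g' x) x) ∧ fnOf s =ᵐ[volume.restrict Ω] g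

/-- `σ ∈ [L²(Ω)]^{2×2}_sym` is an equilibrated moment tensor for `f_h ∈ H⁻²(Ω)`. -/
def IsEquilibrated {Ω : Set Plane} (fh : HMinus2 Ω) (σ : Tensor Ω) : Prop :=
  (∀ i j, σ i j = σ j i) ∧ ∀ w : H20 Ω, divDiv σ w = fh w

/-! ### Triangulations -/

/-- A conforming triangulation of the bounded polygonal domain `Ω` into closed triangles: a finite
geometric simplicial complex all of whose simplices lie in triangles and which fills `Ω̄`. -/
structure Triangulation (Ω : Set Plane) where
  complex : Geometry.SimplicialComplex ℝ Plane
  finite_faces : complex.faces.Finite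
  exists_triangle : ∀ s ∈ complex.faces, ∃ T ∈ complex.faces, s ⊆ T ∧ T.card = 3
  domain_eq : Ω = interior complex.space

namespace Triangulation

variable {Ω : Set Plane} (𝒯 : Triangulation Ω)

/-- The triangles, each given by its set of vertices. -/
def triangles : Finset (Finset Plane) := {T ∈ 𝒯.finite_faces.toFinset | T.card = 3}

/-- The edges, interior and boundary ones, each given by its set of endpoints. -/
def edges : Finset (Finset Plane) := {e ∈ 𝒯.finite_faces.toFinset | e.card = 2}

open Classical in
/-- The edges of the triangle `T`. -/
def edgesOf (T : Finset Plane) : Finset (Finset Plane) := {e ∈ 𝒯.edges | e ⊆ T}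

end Triangulation

/-- The closed triangle or segment with the given vertices. -/
def hull (s : Finset Plane) : Set Plane := convexHull ℝ (s : Set Plane)

/-- `∫_e g ds`, with respect to arc length. -/
def edgeIntegral (e : Finset Plane) (g : Plane → ℝ) : ℝ :=
  ∫ x in hull e, g x ∂(Measure.hausdorffMeasure 1)

/-- A choice, for every edge `e`, of the adjacent triangle `K₊`, of the unit normal `n_e` that points
out of `K₊` (so out of `Ω` if `e` lies on the boundary), and of a unit tangent `τ_e`. -/
structure EdgeFrame {Ω : Set Plane} (𝒯 : Triangulation Ω) where
  plus : Finset Plane → Finset Plane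
  n : Finset Plane → Plane
  τ : Finset Plane → Plane
  plus_mem : ∀ e ∈ 𝒯.edges, plus e ∈ 𝒯.triangles
  subset_plus : ∀ e ∈ 𝒯.edges, e ⊆ plus e
  norm_n : ∀ e ∈ 𝒯.edges, ‖n e‖ = 1
  norm_τ : ∀ e ∈ 𝒯.edges, ‖τ e‖ = 1
  n_perp : ∀ e ∈ 𝒯.edges, ∀ x ∈ e, ∀ y ∈ e, inner ℝ (n e) (y - x) = 0
  τ_perp : ∀ e ∈ 𝒯.edges, inner ℝ (n e) (τ e) = 0
  n_outward : ∀ e ∈ 𝒯.edges, ∀ x ∈ e, ∀ y ∈ plus e, inner ℝ (n e) (y - x) ≤ 0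

namespace EdgeFrame

variable {Ω : Set Plane} {𝒯 : Triangulation Ω} (F : EdgeFrame 𝒯)

open Classical in
/-- The triangles adjacent to `e` other than `K₊`: just `K₋` if `e` is an interior edge, none if `e`
is a boundary edge. -/
def minus (e : Finset Plane) : Finset (Finset Plane) :=
  {T ∈ 𝒯.triangles | e ⊆ T ∧ T ≠ F.plus e}

/-- The jump `φ|_{K₊} - φ|_{K₋}` across an interior edge, and `φ|_{K₊}` on a boundary edge, of a
function that is given by `φ T` on the triangle `T`. -/
def jump (φ : Finset Plane → Plane → ℝ) (e : Finset Plane) (x : Plane) : ℝ :=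
  φ (F.plus e) x - ∑ T ∈ F.minus e, φ T x

/-- The value `(1 - w) φ|_{K₊} + w φ|_{K₋}` on an interior edge, and `φ|_{K₊}` on a boundary edge.
It does not depend on `w` if `φ|_{K₊} = φ|_{K₋}` on `e`; `w = 1/2` gives the average. -/
def edgeValue (w : ℝ) (φ : Finset Plane → Plane → ℝ) (e : Finset Plane) (x : Plane) : ℝ :=
  φ (F.plus e) x - w * ∑ T ∈ F.minus e, (φ (F.plus e) x - φ T x)

end EdgeFrame

/-! ### Piecewise polynomials -/

/-- `ℙ_k(𝒯)`: the functions in `L²(Ω)` that are a polynomial of degree at most `k` on every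
triangle. -/
structure BrokenPoly {Ω : Set Plane} (𝒯 : Triangulation Ω) (k : ℕ) where
  toL2 : L2 Ω
  piece : Finset Plane → MvPolynomial (Fin 2) ℝ
  degree_le : ∀ T ∈ 𝒯.triangles, (piece T).totalDegree ≤ k
  ae_eq : ∀ T ∈ 𝒯.triangles,
    toL2 =ᵐ[volume.restrict (hull T)] fun x => MvPolynomial.eval (fun i => x i) (piece T)

namespace BrokenPoly

variable {Ω : Set Plane} {𝒯 : Triangulation Ω} {k : ℕ} (v : BrokenPoly 𝒯 k)

/-- The polynomial `v|_T`. -/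
def val (T : Finset Plane) (x : Plane) : ℝ := MvPolynomial.eval (fun i => x i) (v.piece T)

/-- The gradient of `v|_T`. -/
def grad (i : Fin 2) (T : Finset Plane) (x : Plane) : ℝ :=
  MvPolynomial.eval (fun i => x i) (MvPolynomial.pderiv i (v.piece T))

/-- The matrix `D²(v|_T)`. -/
def hess (T : Finset Plane) (i j : Fin 2) (x : Plane) : ℝ :=
  MvPolynomial.eval (fun i => x i) (MvPolynomial.pderiv i (MvPolynomial.pderiv j (v.piece T)))

/-- The jump of `v`. -/
def jump (F : EdgeFrame 𝒯) (e : Finset Plane) (x : Plane) : ℝ := F.jump v.val e x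

/-- The jump of the normal derivative `∂_n v = ∇v · n_e`. -/
def jumpN (F : EdgeFrame 𝒯) (e : Finset Plane) (x : Plane) : ℝ :=
  F.jump (fun T y => ∑ i, v.grad i T y * F.n e i) e x

/-- The jump of the tangential derivative `∂_τ v = ∇v · τ_e`. -/
def jumpT (F : EdgeFrame 𝒯) (e : Finset Plane) (x : Plane) : ℝ :=
  F.jump (fun T y => ∑ i, v.grad i T y * F.τ e i) e x

end BrokenPoly

/-! ### Traces on edges -/

/-- The vector field `q` on `U` has the weak divergence `r` and the normal traces `q · n_e = ψ_e` on
the edges `e ∈ s`. As usual, traces are the continuous extension of the restriction of smooth fields: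
fields `Φ_m ∈ C^∞(ℝ²)²` exist such that `Φ_m → q` and `div Φ_m → r` in `L¹(U)` while
`Φ_m · n_e → ψ_e` on `e` in the `L¹` space with weight `|j_e|`. The weight `1` gives the usual trace
in `L¹(e)`; only `j_e ψ_e` matters otherwise. -/
def HasNormalTrace (U : Set Plane) (s : Finset (Finset Plane)) (n : Finset Plane → Plane)
    (j : Finset Plane → Plane → ℝ) (q : Fin 2 → Plane → ℝ) (r : Plane → ℝ)
    (ψ : Finset Plane → Plane → ℝ) : Prop :=
  (∀ i, IntegrableOn (q i) U) ∧ IntegrableOn r U ∧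
  (∀ e ∈ s, IntegrableOn (fun x => j e x * ψ e x) (hull e) (Measure.hausdorffMeasure 1)) ∧
  ∃ Φ : ℕ → Fin 2 → Plane → ℝ,
    (∀ m i, ContDiff ℝ ∞ (Φ m i)) ∧
    (∀ i, Tendsto (fun m => ∫ x in U, |Φ m i x - q i x|) atTop (𝓝 0)) ∧
    Tendsto (fun m => ∫ x in U, |(∑ i, pd i (Φ m i) x) - r x|) atTop (𝓝 0) ∧
    ∀ e ∈ s, Tendsto
      (fun m => edgeIntegral e fun x => |j e x| * |(∑ i, Φ m i x * n e i) - ψ e x|) atTop (𝓝 0)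

/-- The tensor `M` on `U` has the weak divergence `div M` (taken row by row) and the weak second
divergence `div div M` in `L¹(U)`, and on the edges `e ∈ s` the vector `M n_e` has the trace `t_e` in
`L¹(e)` and the scalar `div M · n_e` has the trace `d_e` in the `L¹` space with weight `|j_e|`. -/
def HasMomentTrace (U : Set Plane) (s : Finset (Finset Plane)) (n : Finset Plane → Plane)
    (j : Finset Plane → Plane → ℝ) (M : Fin 2 → Fin 2 → Plane → ℝ)
    (t : Finset Plane → Fin 2 → Plane → ℝ) (d : Finset Plane → Plane → ℝ) : Prop :=
  ∃ (q : Fin 2 → Plane → ℝ) (r : Plane → ℝ),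
    (∀ i, HasNormalTrace U s n (fun _ _ => 1) (M i) (q i) (fun e => t e i)) ∧
    HasNormalTrace U s n j q r d

/-- The traces of a tensor on every edge: `vec e` is `M n_e`, and `div e` is `div M · n_e`. -/
structure EdgeTraces where
  vec : Finset Plane → Fin 2 → Plane → ℝ
  div : Finset Plane → Plane → ℝ

namespace EdgeTraces

variable {Ω : Set Plane} {𝒯 : Triangulation Ω}

/-- `M_nn = n_eᵀ M n_e`. -/
def nn (t : EdgeTraces) (F : EdgeFrame 𝒯) (e : Finset Plane) (x : Plane) : ℝ :=
  ∑ i, F.n e i * t.vec e i x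

/-- `M_nτ = τ_eᵀ M n_e`. -/
def nτ (t : EdgeTraces) (F : EdgeFrame 𝒯) (e : Finset Plane) (x : Plane) : ℝ :=
  ∑ i, F.τ e i * t.vec e i x

/-- The edge values of a tensor whose traces from the triangle `T` are `t T`. -/
def glue (F : EdgeFrame 𝒯) (w : Finset Plane → ℝ) (t : Finset Plane → EdgeTraces) :
    EdgeTraces where
  vec e i := F.edgeValue (w e) (fun T => (t T).vec e i) e
  div e := F.edgeValue (w e) (fun T => (t T).div e) e

end EdgeTraces

/-! ### Estimator and remainder -/

variable {Ω : Set Plane} {𝒯 : Triangulation Ω} {k : ℕ}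

/-- The estimator `η_h`; `S` are the edge values of `σ̃_h^eq`. -/
def estimator (F : EdgeFrame 𝒯) (f : HMinus2 Ω) (uh : BrokenPoly 𝒯 k) (st : H20 Ω)
    (σ σt : Tensor Ω) (S : EdgeTraces) : ℝ :=
  f st - ∑ T ∈ 𝒯.triangles, tensorIntegral (hull T) σ.fn (D2 st).fn
    + ∑ T ∈ 𝒯.triangles, tensorIntegral (hull T) (σ.fn - uh.hess T) σt.fn
    + ∑ e ∈ 𝒯.edges, edgeIntegral e (fun x => uh.jumpT F e x * S.nτ F e x)
    + ∑ e ∈ 𝒯.edges, edgeIntegral e (fun x => uh.jumpN F e x * S.nn F e x)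
    - ∑ e ∈ 𝒯.edges, edgeIntegral e (fun x => uh.jump F e x * S.div e x)

/-- The remainder `R_h`; `S` and `D` are the edge values of `σ̃_h^eq` and of `D²ũ`. -/
def remainder (F : EdgeFrame 𝒯) (f : HMinus2 Ω) (ut : H20 Ω) (uh : BrokenPoly 𝒯 k) (st : H20 Ω)
    (σ σt : Tensor Ω) (S D : EdgeTraces) : ℝ :=
  (f - divDiv σ) (ut - st)
    + ∑ T ∈ 𝒯.triangles, tensorIntegral (hull T) (σ.fn - uh.hess T) ((D2 ut).fn - σt.fn)
    + ∑ e ∈ 𝒯.edges, edgeIntegral e (fun x => uh.jumpT F e x * (D.nτ F e x - S.nτ F e x))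
    + ∑ e ∈ 𝒯.edges, edgeIntegral e (fun x => uh.jumpN F e x * (D.nn F e x - S.nn F e x))
    - ∑ e ∈ 𝒯.edges, edgeIntegral e (fun x => uh.jump F e x * (D.div e x - S.div e x))

end GoalBiharmonic

end

open GoalBiharmonic

/-!
By the primal and the dual equation, `Q(u) = ⟨f, ũ⟩`. Testing the dual equation with `C_c^∞(Ω)`
shows that the function `div div D²ũ` provided by the traces is `f̃`. Green's formula on every
triangle, applied twice and passed to the limit along the smooth fields that define the traces, then
gives `Q(u_h) = ∑_K ∫_K D²u_h : D²ũ -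
  ∑_e ∫_e ([∂_τ u_h] D²_nτ ũ + [∂_n u_h] D²_nn ũ - [u_h] div D²ũ · n_e)`,
because `[∇u_h] · (D²ũ n_e)` splits into its tangential and its normal part. In `η_h + R_h` the
tensors `σ_h`, `σ̃_h` and the function `s̃_h` cancel by linearity, which leaves `⟨f, ũ⟩ - Q(u_h)`.
-/

namespace GoalBiharmonic

/-! ### Triangles in the plane -/

section Oriented

variable {E : Type*} [NormedAddCommGroup E] [InnerProductSpace ℝ E]
  [Fact (Module.finrank ℝ E = 2)] (o : Orientation ℝ E (Fin 2))

theorem areaForm_smul_eq (u v w : E) :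
    o.areaForm u w • v = o.areaForm v w • u + o.areaForm u v • w := by
  refine ext_inner_left ℝ fun a => ?_
  rcases eq_or_ne a 0 with rfl | ha
  · simp
  have key := o.inner_mul_areaForm_sub a
  refine mul_left_cancel₀ (pow_ne_zero 2 (norm_ne_zero_iff.2 ha)) ?_
  simp only [inner_add_right, real_inner_smul_right]
  linear_combination
    inner ℝ a u * key v w - inner ℝ a v * key u w + inner ℝ a w * key u v

theorem areaForm_ne_zero_of_linearIndependent {u w : E} (h : LinearIndependent ℝ ![u, w]) :
    o.areaForm u w ≠ 0 := by
  intro h0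
  have hu : o.areaForm u (o.rightAngleRotation u) = 0 :=
    (LinearIndependent.pair_iff.1 h _ _ (by rw [← areaForm_smul_eq, h0, zero_smul])).2
  rw [o.areaForm_rightAngleRotation_right, inner_self_eq_zero] at hu
  exact h.ne_zero (0 : Fin 2) hu

theorem sign_areaForm_mul_areaForm {ν w z : E} (hν : ‖ν‖ = 1) (hw : inner ℝ ν w = 0)
    (hz : inner ℝ ν z ≤ 0) (hwz : o.areaForm w z ≠ 0) (v : E) :
    SignType.sign (o.areaForm w z) * o.areaForm v w = ‖w‖ * inner ℝ ν v := by
  have key (x y : E) :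
      inner ℝ ν x * o.areaForm ν y - o.areaForm ν x * inner ℝ ν y = o.areaForm x y := by
    rw [o.inner_mul_areaForm_sub, hν, one_pow, one_mul]
  have h_vw : o.areaForm v w = inner ℝ ν v * o.areaForm ν w := by rw [← key, hw]; ring
  have h_wz : o.areaForm w z = o.areaForm ν w * -inner ℝ ν z := by rw [← key, hw]; ring
  have hz' : 0 < -inner ℝ ν z :=
    (neg_nonneg.2 hz).lt_of_ne' fun h => hwz (by rw [h_wz, h, mul_zero])
  rw [h_wz, h_vw, sign_mul, sign_pos hz', mul_one, mul_left_comm, sign_mul_self,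
    o.abs_areaForm_of_orthogonal hw, hν, one_mul, mul_comm]

end Oriented

theorem linearIndependent_sub_of_affineIndependent {V : Type*} [AddCommGroup V] [Module ℝ V]
    {a b c : V} (h : AffineIndependent ℝ ![a, b, c]) :
    LinearIndependent ℝ ![b - a, c - a] := by
  have h' := (affineIndependent_iff_linearIndependent_vsub ℝ _ (0 : Fin 3)).1 h
  have hli := h'.comp (fun i : Fin 2 => ⟨i.succ, i.succ_ne_zero⟩) fun i j hij => by
    simpa using hij
  have hcomp : ![b - a, c - a] = (fun i : {i : Fin 3 // i ≠ 0} => ![a, b, c] i -ᵥ a) ∘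
      fun i : Fin 2 => ⟨i.succ, i.succ_ne_zero⟩ := by
    ext i : 1
    fin_cases i <;> rfl
  exact hcomp ▸ hli

/-- The reference triangle in `ℝ × ℝ`. -/
def refTriangle : Set (ℝ × ℝ) := {p | 0 ≤ p.1 ∧ 0 ≤ p.2 ∧ p.1 + p.2 ≤ 1}

theorem isCompact_refTriangle : IsCompact refTriangle := by
  refine (isCompact_Icc (a := (0 : ℝ × ℝ)) (b := 1)).of_isClosed_subset ?_ ?_
  · exact (isClosed_le continuous_const continuous_fst).inter
      ((isClosed_le continuous_const continuous_snd).inter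
        (isClosed_le (continuous_fst.add continuous_snd) continuous_const))
  · rintro ⟨s, t⟩ ⟨hs, ht, hst⟩
    dsimp only at hs ht hst
    exact ⟨⟨hs, ht⟩, show s ≤ 1 by linarith, show t ≤ 1 by linarith⟩

theorem setIntegral_refTriangle {h : ℝ × ℝ → ℝ} (hh : Continuous h) :
    ∫ p in refTriangle, h p = ∫ t in (0 : ℝ)..1, ∫ s in (0 : ℝ)..(1 - t), h (s, t) := by
  have hint : Integrable (refTriangle.indicator h) (volume.prod volume) :=
    (hh.continuousOn.integrableOn_compact isCompact_refTriangle).integrable_indicator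
      isCompact_refTriangle.measurableSet
  have hmem (s t : ℝ) :
      (s, t) ∈ refTriangle ↔ t ∈ Set.Icc 0 1 ∧ s ∈ Set.Icc 0 (1 - t) := by
    simp only [refTriangle, Set.mem_ofPred_eq, Set.mem_Icc]
    grind
  rw [← integral_indicator isCompact_refTriangle.measurableSet, Measure.volume_eq_prod,
    integral_prod_symm _ hint, intervalIntegral.integral_of_le zero_le_one,
    ← integral_Icc_eq_integral_Ioc, ← integral_indicator measurableSet_Icc]
  refine integral_congr_ae (Eventually.of_forall fun t => ?_)
  by_cases ht : t ∈ Set.Icc (0 : ℝ) 1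
  · have hslice : (fun s => refTriangle.indicator h (s, t)) =
        (Set.Icc 0 (1 - t)).indicator fun s => h (s, t) := by
      ext s
      simp [Set.indicator, hmem, Set.mem_Icc.1 ht]
    simp only [hslice]
    rw [integral_indicator measurableSet_Icc, integral_Icc_eq_integral_Ioc,
      Set.indicator_of_mem ht, intervalIntegral.integral_of_le (sub_nonneg.2 ht.2)]
  · simp [Set.indicator, hmem, ht]

theorem setIntegral_refTriangle_fderiv {G : ℝ × ℝ → ℝ} (hG : ContDiff ℝ 1 G) :
    ∫ p in refTriangle, fderiv ℝ G p (1, 0) = ∫ t in (0 : ℝ)..1, (G (1 - t, t) - G (0, t)) := by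
  have hc : Continuous fun p => fderiv ℝ G p (1, 0) :=
    (hG.continuous_fderiv one_ne_zero).clm_apply continuous_const
  rw [setIntegral_refTriangle hc]
  refine intervalIntegral.integral_congr fun t _ =>
    intervalIntegral.integral_eq_sub_of_hasDerivAt (f := fun s => G (s, t)) (fun s _ => ?_)
      (hc.comp (.prodMk_left t)).continuousOn.intervalIntegrable
  exact (hG.differentiable one_ne_zero _).hasFDerivAt.comp_hasDerivAt s
    ((hasDerivAt_id s).prodMk (hasDerivAt_const s t))

/-- The affine map of the reference triangle onto the triangle `abc`. -/
def triangleMap {V : Type*} [AddCommGroup V] [Module ℝ V] (a b c : V) (p : ℝ × ℝ) : V :=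
  a + (p.1 • (b - a) + p.2 • (c - a))

theorem isCompact_hull (s : Finset Plane) : IsCompact (hull s) :=
  s.finite_toSet.isCompact_convexHull ℝ

theorem hull_triple (a b c : Plane) : hull {a, b, c} = triangleMap a b c '' refTriangle := by
  rw [hull, Finset.coe_insert, Finset.coe_pair]
  refine Set.Subset.antisymm (convexHull_min ?_ ?_) ?_
  · rintro x (rfl | rfl | rfl)
    · exact ⟨(0, 0), by simp [refTriangle], by simp [triangleMap]⟩
    · exact ⟨(1, 0), by simp [refTriangle], by simp [triangleMap]⟩
    · exact ⟨(0, 1), by simp [refTriangle], by simp [triangleMap]⟩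
  · rintro _ ⟨p, ⟨hp1, hp2, hp3⟩, rfl⟩ _ ⟨q, ⟨hq1, hq2, hq3⟩, rfl⟩ s t hs ht hst
    refine ⟨s • p + t • q, ⟨?_, ?_, ?_⟩, ?_⟩
    · simp only [Prod.fst_add, Prod.smul_fst, smul_eq_mul]
      positivity
    · simp only [Prod.snd_add, Prod.smul_snd, smul_eq_mul]
      positivity
    · simp only [Prod.fst_add, Prod.smul_fst, smul_eq_mul, Prod.snd_add, Prod.smul_snd]
      nlinarith
    · obtain rfl : t = 1 - s := by linarith
      simp only [triangleMap, Prod.fst_add, Prod.smul_fst, smul_eq_mul, Prod.snd_add,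
        Prod.smul_snd]
      module
  · rintro _ ⟨p, ⟨hp1, hp2, hp3⟩, rfl⟩
    have hsum := (convex_convexHull ℝ ({a, b, c} : Set Plane)).sum_mem (t := Finset.univ)
      (w := ![1 - p.1 - p.2, p.1, p.2]) (z := ![a, b, c]) ?_ ?_ ?_
    · convert hsum using 1
      simp only [Fin.sum_univ_three, Matrix.cons_val, triangleMap]
      module
    · intro i _
      fin_cases i <;> simp <;> linarith
    · simp only [Fin.sum_univ_three, Matrix.cons_val]
      ring
    · intro i _
      fin_cases i <;> exact subset_convexHull ℝ _ (by simp)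

instance : Fact (Module.finrank ℝ Plane = 2) := ⟨finrank_euclideanSpace_fin⟩

theorem setIntegral_hull_triple (o : Orientation ℝ Plane (Fin 2)) {a b c : Plane}
    (hω : o.areaForm (b - a) (c - a) ≠ 0) (h : Plane → ℝ) :
    ∫ x in hull {a, b, c}, h x =
      |o.areaForm (b - a) (c - a)| * ∫ p in refTriangle, h (triangleMap a b c p) := by
  let e := EuclideanSpace.basisFun (Fin 2) ℝ
  let L : Plane →L[ℝ] Plane := (e.toBasis.constr ℝ ![b - a, c - a]).toContinuousLinearMap
  have hdet : |L.det| = |o.areaForm (b - a) (c - a)| := by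
    have hLe : (e.toBasis.constr ℝ ![b - a, c - a]) ∘ e.toBasis = ![b - a, c - a] :=
      funext fun i => e.toBasis.constr_basis ℝ _ i
    have hcomp := e.toBasis.det_comp (e.toBasis.constr ℝ ![b - a, c - a]) e.toBasis
    rw [hLe, e.toBasis.det_self, mul_one] at hcomp
    rw [o.areaForm_to_volumeForm, o.volumeForm_robust' e, hcomp]
    rfl
  let coord : Plane ≃ᵐ ℝ × ℝ :=
    (MeasurableEquiv.toLp 2 (Fin 2 → ℝ)).symm.trans MeasurableEquiv.finTwoArrow
  have hcoord : MeasurePreserving coord volume volume :=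
    (volume_preserving_finTwoArrow ℝ).comp
      (EuclideanSpace.volume_preserving_symm_measurableEquiv_toLp (Fin 2))
  have hL (x : Plane) : a + L x = triangleMap a b c (coord x) := by
    simp [L, e, triangleMap, coord, Module.Basis.constr_apply_fintype]
  have hinj : Function.Injective fun x => a + L x := by
    refine (add_right_injective a).comp (LinearMap.ker_eq_bot.1 ?_)
    by_contra hker
    exact hω (abs_eq_zero.1 (hdet ▸ abs_eq_zero.2 (LinearMap.det_eq_zero_iff_ker_ne_bot.2 hker)))
  have himage : hull {a, b, c} = (fun x => a + L x) '' (coord ⁻¹' refTriangle) := by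
    simp_rw [hL]
    rw [hull_triple, ← Function.comp_def (triangleMap a b c) coord, Set.image_comp,
      Set.image_preimage_eq _ coord.surjective]
  rw [himage, integral_image_eq_integral_abs_det_fderiv_smul volume (f' := fun _ => L)
    (coord.measurable isCompact_refTriangle.measurableSet)
    (fun x _ => (L.hasFDerivAt.const_add a).hasFDerivWithinAt) hinj.injOn]
  simp_rw [hL, hdet, smul_eq_mul]
  rw [integral_const_mul]
  congr 1
  exact hcoord.setIntegral_preimage_emb coord.measurableEmbedding
    (fun p => h (triangleMap a b c p)) _

/-- The mean value of `g` over the segment from `x` to `y`. -/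
noncomputable def segmentMean (g : Plane → ℝ) (x y : Plane) : ℝ :=
  ∫ t in (0 : ℝ)..1, g (x + t • (y - x))

theorem segmentMean_symm (g : Plane → ℝ) (x y : Plane) : segmentMean g x y = segmentMean g y x := by
  have hflip (t : ℝ) : x + (1 - t) • (y - x) = y + t • (x - y) := by module
  have h := intervalIntegral.integral_comp_sub_left (a := 0) (b := 1)
    (fun t : ℝ => g (x + t • (y - x))) 1
  simp only [hflip, sub_self, sub_zero] at h
  exact h.symm

theorem edgeIntegral_pair {x y : Plane} (hxy : x ≠ y) (g : Plane → ℝ) :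
    edgeIntegral {x, y} g = ‖y - x‖ * segmentMean g x y := by
  have hemb : MeasurableEmbedding (AffineMap.lineMap x y : ℝ → Plane) :=
    Continuous.measurableEmbedding (by fun_prop) (AffineMap.lineMap_injective ℝ hxy)
  have hseg : hull {x, y} = AffineMap.lineMap x y '' Set.Icc (0 : ℝ) 1 := by
    rw [hull, Finset.coe_pair, convexHull_pair, segment_eq_image_lineMap]
  have hmeas : (Measure.hausdorffMeasure 1 : Measure Plane).restrict (hull {x, y}) =
      nndist x y • ((volume : Measure ℝ).restrict (Set.Icc 0 1)).map (AffineMap.lineMap x y) := by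
    ext s hs
    rw [Measure.restrict_apply hs, hseg, Measure.smul_apply, Measure.map_apply hemb.measurable hs,
      Measure.restrict_apply (hemb.measurable hs), Set.inter_comm, ← Set.image_inter_preimage,
      hausdorffMeasure_lineMap_image, hausdorffMeasure_real, Set.inter_comm]
  rw [edgeIntegral, hmeas, integral_smul_nnreal_measure, hemb.integral_map, segmentMean,
    intervalIntegral.integral_of_le zero_le_one, integral_Icc_eq_integral_Ioc, NNReal.smul_def,
    coe_nndist, dist_comm, dist_eq_norm, smul_eq_mul]
  simp only [AffineMap.lineMap_apply, vsub_eq_sub, vadd_eq_add, add_comm]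

theorem setIntegral_hull_fderiv_sub (o : Orientation ℝ Plane (Fin 2)) {a b c : Plane}
    (hω : o.areaForm (b - a) (c - a) ≠ 0) {G : Plane → ℝ} (hG : ContDiff ℝ 1 G) :
    ∫ x in hull {a, b, c}, fderiv ℝ G x (b - a) =
      |o.areaForm (b - a) (c - a)| * (segmentMean G b c - segmentMean G a c) := by
  have hmap (p : ℝ × ℝ) : HasFDerivAt (triangleMap a b c)
      ((ContinuousLinearMap.fst ℝ ℝ ℝ).smulRight (b - a) +
        (ContinuousLinearMap.snd ℝ ℝ ℝ).smulRight (c - a)) p :=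
    ((ContinuousLinearMap.fst ℝ ℝ ℝ).smulRight (b - a) +
      (ContinuousLinearMap.snd ℝ ℝ ℝ).smulRight (c - a)).hasFDerivAt.const_add a
  have hchain (p : ℝ × ℝ) : fderiv ℝ G (triangleMap a b c p) (b - a) =
      fderiv ℝ (G ∘ triangleMap a b c) p (1, 0) := by
    rw [((hG.differentiable one_ne_zero _).hasFDerivAt.comp p (hmap p)).fderiv]
    simp
  have hGmap : ContDiff ℝ 1 (G ∘ triangleMap a b c) :=
    hG.comp (by unfold triangleMap; fun_prop)
  have hint (x y : Plane) : IntervalIntegrable (fun t : ℝ => G (x + t • y)) volume 0 1 :=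
    (hG.continuous.comp (by fun_prop)).intervalIntegrable _ _
  have hbc (t : ℝ) : triangleMap a b c (1 - t, t) = b + t • (c - b) := by
    simp only [triangleMap]
    module
  have hac (t : ℝ) : triangleMap a b c (0, t) = a + t • (c - a) := by
    simp only [triangleMap]
    module
  simp_rw [setIntegral_hull_triple o hω, hchain, setIntegral_refTriangle_fderiv hGmap,
    Function.comp_apply, hbc, hac]
  rw [intervalIntegral.integral_sub (hint _ _) (hint _ _), segmentMean, segmentMean]

theorem setIntegral_hull_triple_fderiv (o : Orientation ℝ Plane (Fin 2)) {a b c : Plane}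
    (hω : o.areaForm (b - a) (c - a) ≠ 0) {G : Plane → ℝ} (hG : ContDiff ℝ 1 G) (v : Plane) :
    ∫ x in hull {a, b, c}, fderiv ℝ G x v =
      SignType.sign (o.areaForm (b - a) (c - a)) *
        (o.areaForm v (b - a) * segmentMean G a b + o.areaForm v (c - b) * segmentMean G b c +
          o.areaForm v (a - c) * segmentMean G c a) := by
  have hint (w : Plane) : IntegrableOn (fun x => fderiv ℝ G x w) (hull {a, b, c}) :=
    ((hG.continuous_fderiv one_ne_zero).clm_apply
      continuous_const).continuousOn.integrableOn_compact (isCompact_hull _)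
  have hb := setIntegral_hull_fderiv_sub o hω hG
  have hc : ∫ x in hull {a, b, c}, fderiv ℝ G x (c - a) =
      |o.areaForm (b - a) (c - a)| * (segmentMean G b c - segmentMean G a b) := by
    have hω' : o.areaForm (c - a) (b - a) ≠ 0 := by rwa [o.areaForm_swap, neg_ne_zero]
    rw [Finset.pair_comm, setIntegral_hull_fderiv_sub o hω' hG, o.areaForm_swap, abs_neg,
      segmentMean_symm G c b]
  refine mul_left_cancel₀ hω ?_
  have hcramer (x : Plane) : o.areaForm (b - a) (c - a) * fderiv ℝ G x v =
      o.areaForm v (c - a) * fderiv ℝ G x (b - a) +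
        o.areaForm (b - a) v * fderiv ℝ G x (c - a) := by
    rw [← smul_eq_mul, ← map_smul, areaForm_smul_eq o, map_add, map_smul, map_smul, smul_eq_mul,
      smul_eq_mul]
  have hcb : o.areaForm v (c - b) = o.areaForm v (c - a) - o.areaForm v (b - a) := by
    rw [← map_sub, sub_sub_sub_cancel_right]
  have hca : o.areaForm v (a - c) = -o.areaForm v (c - a) := by rw [← map_neg, neg_sub]
  rw [← integral_const_mul, integral_congr_ae (Eventually.of_forall hcramer),
    integral_add ((hint _).const_mul _) ((hint _).const_mul _), integral_const_mul,
    integral_const_mul, hb, hc, o.areaForm_swap (b - a) v, hcb, hca,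
    segmentMean_symm G c a, ← sign_mul_self]
  ring

theorem sum_powersetCard_two_triple {α M : Type*} [DecidableEq α] [AddCommMonoid M] {a b c : α}
    (hab : a ≠ b) (hac : a ≠ c) (hbc : b ≠ c) (f : Finset α → M) :
    ∑ e ∈ Finset.powersetCard 2 {a, b, c}, f e = f {a, b} + f {b, c} + f {c, a} := by
  have hself : Finset.powersetCard 2 {b, c} = {{b, c}} :=
    Finset.card_pair hbc ▸ Finset.powersetCard_self {b, c}
  have hset : Finset.powersetCard 2 {a, b, c} = {{a, b}, {b, c}, {c, a}} := by
    rw [Finset.powersetCard_succ_insert (by simp [hab, hac]), Finset.powersetCard_one, hself,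
      Finset.pair_comm c a]
    ext e
    simp
  have hbc' : ({a, b} : Finset α) ≠ {b, c} :=
    ne_of_mem_of_not_mem' (a := a) (by simp) (by simp [hab, hac])
  have hca : ({a, b} : Finset α) ≠ {c, a} :=
    ne_of_mem_of_not_mem' (a := b) (by simp) (by simp [hab.symm, hbc])
  have hcb : ({b, c} : Finset α) ≠ {c, a} :=
    ne_of_mem_of_not_mem' (a := b) (by simp) (by simp [hab.symm, hbc])
  rw [hset, Finset.sum_insert (by simp [hbc', hca]), Finset.sum_pair hcb, add_assoc]

theorem areaForm_ne_zero_of_affineIndependent (o : Orientation ℝ Plane (Fin 2))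
    {T : Finset Plane} (h : AffineIndependent ℝ ((↑) : T → Plane)) {a b c : Plane}
    (ha : a ∈ T) (hb : b ∈ T) (hc : c ∈ T) (hab : a ≠ b) (hac : a ≠ c) (hbc : b ≠ c) :
    o.areaForm (b - a) (c - a) ≠ 0 := by
  let p : Fin 3 → T := ![⟨a, ha⟩, ⟨b, hb⟩, ⟨c, hc⟩]
  have hinj : Function.Injective p := by
    intro i j hij
    fin_cases i <;> fin_cases j <;> simp_all [p]
  have hp : (fun i => (p i : Plane)) = ![a, b, c] :=
    funext fun i => by fin_cases i <;> rfl
  exact areaForm_ne_zero_of_linearIndependent o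
    (linearIndependent_sub_of_affineIndependent (hp ▸ h.comp_embedding ⟨p, hinj⟩))

theorem setIntegral_hull_fderiv {T : Finset Plane} (hT : T.card = 3)
    (hind : AffineIndependent ℝ ((↑) : T → Plane)) {ν : Finset Plane → Plane}
    (hnorm : ∀ e ∈ T.powersetCard 2, ‖ν e‖ = 1)
    (hperp : ∀ e ∈ T.powersetCard 2, ∀ x ∈ e, ∀ y ∈ e, inner ℝ (ν e) (y - x) = 0)
    (hout : ∀ e ∈ T.powersetCard 2, ∀ x ∈ e, ∀ y ∈ T, inner ℝ (ν e) (y - x) ≤ 0)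
    {G : Plane → ℝ} (hG : ContDiff ℝ 1 G) (v : Plane) :
    ∫ x in hull T, fderiv ℝ G x v =
      ∑ e ∈ T.powersetCard 2, inner ℝ (ν e) v * edgeIntegral e G := by
  classical
  obtain ⟨a, b, c, hab, hac, hbc, rfl⟩ := Finset.card_eq_three.1 hT
  let o : Orientation ℝ Plane (Fin 2) := (EuclideanSpace.basisFun (Fin 2) ℝ).toBasis.orientation
  have hω : o.areaForm (b - a) (c - a) ≠ 0 :=
    areaForm_ne_zero_of_affineIndependent o hind (by simp) (by simp) (by simp) hab hac hbc
  have hedge {x y z : Plane} (hxy : x ≠ y) (hx : x ∈ ({a, b, c} : Finset Plane))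
      (hy : y ∈ ({a, b, c} : Finset Plane)) (hz : z ∈ ({a, b, c} : Finset Plane))
      (hcyc : o.areaForm (y - x) (z - x) = o.areaForm (b - a) (c - a)) :
      inner ℝ (ν {x, y}) v * edgeIntegral {x, y} G =
        SignType.sign (o.areaForm (b - a) (c - a)) *
          (o.areaForm v (y - x) * segmentMean G x y) := by
    have he : {x, y} ∈ Finset.powersetCard 2 {a, b, c} :=
      Finset.mem_powersetCard.2
        ⟨Finset.insert_subset hx (Finset.singleton_subset_iff.2 hy), Finset.card_pair hxy⟩
    rw [← hcyc] at hω ⊢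
    rw [edgeIntegral_pair hxy, ← mul_assoc, ← mul_assoc,
      sign_areaForm_mul_areaForm o (hnorm _ he)
        (hperp _ he x (Finset.mem_insert_self _ _) y (by simp))
        (hout _ he x (Finset.mem_insert_self _ _) z hz) hω, mul_comm ‖y - x‖]
  have hcyc (x y z : Plane) :
      o.areaForm (z - y) (x - y) = o.areaForm (y - x) (z - x) := by
    simp only [map_sub, LinearMap.sub_apply, o.areaForm_apply_self]
    rw [o.areaForm_swap z x, o.areaForm_swap z y, o.areaForm_swap y x]
    abel
  rw [sum_powersetCard_two_triple hab hac hbc, setIntegral_hull_triple_fderiv o hω hG,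
    hedge hab (by simp) (by simp) (by simp) (z := c) rfl,
    hedge hbc (by simp) (by simp) (by simp) (z := a) (hcyc _ _ _),
    hedge hac.symm (by simp) (by simp) (by simp) (z := b) ((hcyc _ _ _).trans (hcyc _ _ _))]
  ring

/-! ### Triangulations -/

theorem eq_triangleMap (o : Orientation ℝ Plane (Fin 2)) {a b c : Plane}
    (hω : o.areaForm (b - a) (c - a) ≠ 0) (z : Plane) :
    z = triangleMap a b c (o.areaForm (z - a) (c - a) / o.areaForm (b - a) (c - a),
      o.areaForm (b - a) (z - a) / o.areaForm (b - a) (c - a)) := by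
  simp only [triangleMap, div_eq_inv_mul, ← smul_smul, ← smul_add, ← areaForm_smul_eq,
    inv_smul_smul₀ hω, add_sub_cancel]

theorem hull_mem_nhdsWithin_midpoint (o : Orientation ℝ Plane (Fin 2)) {a b c n : Plane}
    (hω : o.areaForm (b - a) (c - a) ≠ 0) (hb : inner ℝ n (b - a) = 0)
    (hc : inner ℝ n (c - a) < 0) :
    hull {a, b, c} ∈ 𝓝[{z | inner ℝ n (z - a) ≤ 0}] midpoint ℝ a b := by
  let β (z : Plane) : ℝ := o.areaForm (z - a) (c - a) / o.areaForm (b - a) (c - a)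
  let γ (z : Plane) : ℝ := o.areaForm (b - a) (z - a) / o.areaForm (b - a) (c - a)
  have hz (z : Plane) : z = triangleMap a b c (β z, γ z) := eq_triangleMap o hω z
  have hγ {z : Plane} (hzn : inner ℝ n (z - a) ≤ 0) : 0 ≤ γ z := by
    have h : inner ℝ n (z - a) = γ z * inner ℝ n (c - a) := by
      conv_lhs => rw [hz z, triangleMap, add_sub_cancel_left]
      rw [inner_add_right, real_inner_smul_right, hb, mul_zero, zero_add, real_inner_smul_right]
    exact nonneg_of_mul_nonpos_left (h ▸ hzn) hc
  have hmid : midpoint ℝ a b - a = (2⁻¹ : ℝ) • (b - a) := by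
    simp
  have hβ_mid : β (midpoint ℝ a b) = 2⁻¹ := by
    simp only [β, hmid, map_smul, LinearMap.smul_apply, smul_eq_mul]
    exact mul_div_cancel_right₀ _ hω
  have hγ_mid : γ (midpoint ℝ a b) = 0 := by
    simp only [γ, hmid, map_smul, o.areaForm_apply_self, smul_zero, zero_div]
  have hβ_cont : Continuous β :=
    ((o.areaForm.flip (c - a)).continuous_of_finiteDimensional.comp
      (continuous_id.sub continuous_const)).div_const _
  have hγ_cont : Continuous γ :=
    ((o.areaForm (b - a)).continuous_of_finiteDimensional.comp
      (continuous_id.sub continuous_const)).div_const _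
  have hβ_pos : ∀ᶠ z in 𝓝 (midpoint ℝ a b), 0 < β z :=
    hβ_cont.continuousAt.eventually_const_lt (by rw [hβ_mid]; norm_num)
  have hβγ_lt : ∀ᶠ z in 𝓝 (midpoint ℝ a b), β z + γ z < 1 :=
    (hβ_cont.add hγ_cont).continuousAt.eventually_lt_const (by
      change β _ + γ _ < 1
      rw [hβ_mid, hγ_mid]
      norm_num)
  filter_upwards [self_mem_nhdsWithin, hβ_pos.filter_mono nhdsWithin_le_nhds,
    hβγ_lt.filter_mono nhdsWithin_le_nhds] with z hzn hβz hβγz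
  rw [hull_triple, hz z]
  exact ⟨_, ⟨hβz.le, hγ hzn, hβγz.le⟩, rfl⟩

theorem volume_hull_of_card_le_two {s : Finset Plane} (hs : s.card ≤ 2) :
    volume (hull s) = 0 := by
  rcases s.eq_empty_or_nonempty with rfl | hne
  · simp [hull]
  refine measure_mono_null (convexHull_subset_affineSpan (𝕜 := ℝ) (s : Set Plane))
    (Measure.addHaar_affineSubspace _ _ fun htop => ?_)
  have : Nonempty s := hne.to_subtype
  have hrank := finrank_vectorSpan_range_add_one_le ℝ ((↑) : s → Plane)
  rw [Subtype.range_coe_subtype, Fintype.card_coe] at hrank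
  change Module.finrank ℝ (vectorSpan ℝ (s : Set Plane)) + 1 ≤ _ at hrank
  rw [← direction_affineSpan, htop, AffineSubspace.direction_top, finrank_top,
    finrank_euclideanSpace_fin] at hrank
  omega

theorem hausdorffMeasure_hull_lt_top {e : Finset Plane} (he : e.card = 2) :
    Measure.hausdorffMeasure 1 (hull e) < ⊤ := by
  obtain ⟨a, b, -, rfl⟩ := Finset.card_eq_two.1 he
  rw [hull, Finset.coe_pair, convexHull_pair, hausdorffMeasure_segment]
  exact edist_lt_top a b

theorem integrableOn_hull_of_continuous {e : Finset Plane} (he : e.card = 2) {g : Plane → ℝ}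
    (hg : Continuous g) : IntegrableOn g (hull e) (Measure.hausdorffMeasure 1) :=
  hg.continuousOn.integrableOn_of_subset_isCompact (isCompact_hull e)
    (isCompact_hull e).measurableSet subset_rfl (hausdorffMeasure_hull_lt_top he).ne

namespace Triangulation

variable {Ω : Set Plane} (𝒯 : Triangulation Ω)

theorem mem_triangles {T : Finset Plane} :
    T ∈ 𝒯.triangles ↔ T ∈ 𝒯.complex.faces ∧ T.card = 3 := by
  simp [triangles]

theorem mem_edges {e : Finset Plane} : e ∈ 𝒯.edges ↔ e ∈ 𝒯.complex.faces ∧ e.card = 2 := by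
  simp [edges]

theorem mem_edges_of_subset {T e : Finset Plane} (hT : T ∈ 𝒯.triangles)
    (he : e ∈ T.powersetCard 2) : e ∈ 𝒯.edges := by
  obtain ⟨heT, hcard⟩ := Finset.mem_powersetCard.1 he
  exact 𝒯.mem_edges.2 ⟨𝒯.complex.down_closed (𝒯.mem_triangles.1 hT).1 heT
    (Finset.card_pos.1 (by omega)), hcard⟩

theorem space_eq : 𝒯.complex.space = ⋃ T ∈ 𝒯.triangles, hull T := by
  ext x
  simp only [Geometry.SimplicialComplex.mem_space_iff, Set.mem_iUnion, exists_prop]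
  constructor
  · rintro ⟨s, hs, hx⟩
    obtain ⟨T, hT, hsT, hcard⟩ := 𝒯.exists_triangle s hs
    exact ⟨T, 𝒯.mem_triangles.2 ⟨hT, hcard⟩, convexHull_mono (Finset.coe_subset.2 hsT) hx⟩
  · rintro ⟨T, hT, hx⟩
    exact ⟨T, (𝒯.mem_triangles.1 hT).1, hx⟩

theorem isOpen_domain (𝒯 : Triangulation Ω) : IsOpen Ω := 𝒯.domain_eq ▸ isOpen_interior

theorem isCompact_space : IsCompact 𝒯.complex.space := by
  rw [space_eq]
  exact 𝒯.triangles.finite_toSet.isCompact_biUnion fun T _ => isCompact_hull T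

theorem domain_subset_space : Ω ⊆ 𝒯.complex.space := by
  conv_lhs => rw [𝒯.domain_eq]
  exact interior_subset

theorem domain_ae_eq : Ω =ᵐ[volume] ⋃ T ∈ 𝒯.triangles, hull T := by
  rw [← space_eq]
  refine (LE.le.eventuallyLE 𝒯.domain_subset_space).antisymm ?_
  rw [ae_le_set]
  refine measure_mono_null (t := ⋃ T ∈ 𝒯.triangles, frontier (hull T)) ?_
    ((measure_biUnion_null_iff 𝒯.triangles.countable_toSet).2 fun T _ =>
      (convex_convexHull ℝ _).addHaar_frontier volume)
  rintro x ⟨hx, hxΩ⟩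
  rw [space_eq] at hx
  simp only [Set.mem_iUnion, exists_prop] at hx ⊢
  obtain ⟨T, hT, hxT⟩ := hx
  refine ⟨T, hT, subset_closure hxT, fun hxi => hxΩ ?_⟩
  rw [𝒯.domain_eq]
  exact interior_mono
    (Geometry.SimplicialComplex.convexHull_subset_space (𝒯.mem_triangles.1 hT).1) hxi

theorem hull_ae_le_domain {T : Finset Plane} (hT : T ∈ 𝒯.triangles) : hull T ≤ᵐ[volume] Ω :=
  (LE.le.eventuallyLE (Set.subset_biUnion_of_mem (u := hull)
    (Finset.mem_coe.2 hT))).trans 𝒯.domain_ae_eq.symm.le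

theorem inter_hull_subset {T T' : Finset Plane} (hT : T ∈ 𝒯.triangles) (hT' : T' ∈ 𝒯.triangles)
    {s : Finset Plane} (hs : ∀ x ∈ T, x ∈ T' → x ∈ s) : hull T ∩ hull T' ⊆ hull s :=
  (𝒯.complex.inter_subset_convexHull (𝒯.mem_triangles.1 hT).1 (𝒯.mem_triangles.1 hT').1).trans
    (convexHull_mono fun x hx => hs x hx.1 hx.2)

theorem aedisjoint_hull {T T' : Finset Plane} (hT : T ∈ 𝒯.triangles) (hT' : T' ∈ 𝒯.triangles)
    (hne : T ≠ T') : AEDisjoint volume (hull T) (hull T') := by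
  classical
  refine measure_mono_null (𝒯.inter_hull_subset hT hT' (s := T ∩ T') (by simp +contextual))
    (volume_hull_of_card_le_two ?_)
  by_contra hlt
  have hcard := (𝒯.mem_triangles.1 hT).2
  have hcard' := (𝒯.mem_triangles.1 hT').2
  have hsub : T ∩ T' = T := Finset.eq_of_subset_of_card_le Finset.inter_subset_left (by omega)
  have hsub' : T ∩ T' = T' :=
    Finset.eq_of_subset_of_card_le Finset.inter_subset_right (by omega)
  exact hne (hsub.symm.trans hsub')

theorem setIntegral_domain {f : Plane → ℝ} (hf : IntegrableOn f Ω) :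
    ∫ x in Ω, f x = ∑ T ∈ 𝒯.triangles, ∫ x in hull T, f x := by
  have hU : (⋃ T ∈ 𝒯.triangles, hull T) = ⋃ T : 𝒯.triangles, hull (T : Finset Plane) := by
    rw [Set.iUnion_subtype]
  rw [setIntegral_congr_set 𝒯.domain_ae_eq, hU, integral_iUnion_ae
    (fun T => (isCompact_hull _).measurableSet.nullMeasurableSet), tsum_fintype,
    Finset.sum_coe_sort 𝒯.triangles (fun T => ∫ x in hull T, f x)]
  · exact fun T T' hne => 𝒯.aedisjoint_hull T.2 T'.2 fun h => hne (Subtype.ext h)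
  · rw [← hU]
    exact hf.congr_set_ae 𝒯.domain_ae_eq.symm

end Triangulation

theorem inner_sub_eq_zero_of_mem_hull {e : Finset Plane} {n a z : Plane}
    (h : ∀ y ∈ e, inner ℝ n (y - a) = 0) (hz : z ∈ hull e) : inner ℝ n (z - a) = 0 := by
  simp only [inner_sub_right, sub_eq_zero] at h ⊢
  exact convexHull_min h (convex_hyperplane (innerSL ℝ n).toLinearMap.isLinear _) hz

theorem hull_notMem_nhdsWithin_midpoint {e : Finset Plane} {n a b : Plane} (hn : ‖n‖ = 1)
    (h : ∀ y ∈ e, inner ℝ n (y - a) = 0) (hb : b ∈ e) :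
    hull e ∉ 𝓝[{z | inner ℝ n (z - a) ≤ 0}] midpoint ℝ a b := by
  intro hmem
  have hmid : inner ℝ n (midpoint ℝ a b - a) = 0 := by
    simp [real_inner_smul_right, h b hb]
  have hinner (t : ℝ) : inner ℝ n (midpoint ℝ a b - t • n - a) = -t := by
    rw [sub_right_comm, inner_sub_right, hmid, real_inner_smul_right,
      real_inner_self_eq_norm_sq, hn]
    ring
  have hlim : Tendsto (fun t : ℝ => midpoint ℝ a b - t • n) (𝓝[>] 0)
      (𝓝[{z | inner ℝ n (z - a) ≤ 0}] midpoint ℝ a b) := by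
    refine tendsto_nhdsWithin_iff.2 ⟨?_, ?_⟩
    · exact tendsto_nhdsWithin_of_tendsto_nhds
        (Continuous.tendsto' (by fun_prop) _ _ (by simp))
    · filter_upwards [self_mem_nhdsWithin] with t ht
      exact (hinner t).trans_le (neg_nonpos.2 (le_of_lt ht))
  obtain ⟨t, htmem, ht⟩ := ((hlim.eventually hmem).and self_mem_nhdsWithin).exists
  exact (neg_neg_of_pos ht).ne ((hinner t).symm.trans (inner_sub_eq_zero_of_mem_hull h htmem))

namespace EdgeFrame

variable {Ω : Set Plane} {𝒯 : Triangulation Ω} (F : EdgeFrame 𝒯)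

theorem mem_minus {e T : Finset Plane} :
    T ∈ F.minus e ↔ T ∈ 𝒯.triangles ∧ e ⊆ T ∧ T ≠ F.plus e := by
  simp [minus]

theorem n_outward_lt {e : Finset Plane} (he : e ∈ 𝒯.edges) {x y : Plane} (hx : x ∈ e)
    (hy : y ∈ F.plus e) (hye : y ∉ e) : inner ℝ (F.n e) (y - x) < 0 := by
  refine (F.n_outward e he x hx y hy).lt_of_ne fun h => ?_
  obtain ⟨b, hb, hbx⟩ := Finset.exists_mem_ne ((𝒯.mem_edges.1 he).2 ▸ one_lt_two) x
  let o : Orientation ℝ Plane (Fin 2) := (EuclideanSpace.basisFun (Fin 2) ℝ).toBasis.orientation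
  have hdet := o.inner_mul_areaForm_sub (F.n e) (b - x) (y - x)
  rw [F.n_perp e he x hx b hb, h, F.norm_n e he, one_pow, one_mul, zero_mul, mul_zero,
    sub_zero] at hdet
  exact areaForm_ne_zero_of_affineIndependent o
    (𝒯.complex.indep (𝒯.mem_triangles.1 (F.plus_mem e he)).1) (F.subset_plus e he hx)
    (F.subset_plus e he hb) hy hbx.symm (ne_of_mem_of_not_mem hx hye)
    (ne_of_mem_of_not_mem hb hye) hdet.symm

theorem exists_eq_insert {e T : Finset Plane} (he : e ∈ 𝒯.edges) (hT : T ∈ 𝒯.triangles)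
    (heT : e ⊆ T) : ∃ c ∉ e, insert c e = T :=
  Finset.exists_eq_insert_iff.2
    ⟨heT, by rw [(𝒯.mem_edges.1 he).2, (𝒯.mem_triangles.1 hT).2]⟩

theorem hull_insert_mem_nhdsWithin {e : Finset Plane} (he : e ∈ 𝒯.edges) {a b c : Plane}
    (hT : insert c e ∈ 𝒯.triangles) (hce : c ∉ e) (ha : a ∈ e) (hb : b ∈ e) (hab : a ≠ b)
    (hc : inner ℝ (F.n e) (c - a) < 0) :
    hull (insert c e) ∈ 𝓝[{z | inner ℝ (F.n e) (z - a) ≤ 0}] midpoint ℝ a b := by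
  have hpair : e = {a, b} := (Finset.eq_of_subset_of_card_le
    (Finset.insert_subset ha (Finset.singleton_subset_iff.2 hb))
    (by rw [Finset.card_pair hab, (𝒯.mem_edges.1 he).2])).symm
  have htriple : insert c e = {a, b, c} := by
    rw [hpair, Finset.insert_comm, Finset.pair_comm]
  rw [htriple] at hT ⊢
  let o : Orientation ℝ Plane (Fin 2) := (EuclideanSpace.basisFun (Fin 2) ℝ).toBasis.orientation
  exact hull_mem_nhdsWithin_midpoint o
    (areaForm_ne_zero_of_affineIndependent o (𝒯.complex.indep (𝒯.mem_triangles.1 hT).1)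
      (by simp) (by simp) (by simp) hab (ne_of_mem_of_not_mem ha hce)
      (ne_of_mem_of_not_mem hb hce))
    (F.n_perp e he a ha b hb) hc

/-- Otherwise `T` and `K₊` would both fill a half disc at the midpoint of `e`, on the same side. -/
theorem n_inward {e T : Finset Plane} (he : e ∈ 𝒯.edges) (hT : T ∈ F.minus e) {x y : Plane}
    (hx : x ∈ e) (hy : y ∈ T) : 0 ≤ inner ℝ (F.n e) (y - x) := by
  obtain ⟨hTt, heT, hne⟩ := F.mem_minus.1 hT
  by_contra! hlt
  have hye : y ∉ e := fun hye => hlt.ne (F.n_perp e he x hx y hye)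
  obtain ⟨b, hb, hbx⟩ := Finset.exists_mem_ne ((𝒯.mem_edges.1 he).2 ▸ one_lt_two) x
  obtain ⟨c, hce, hc⟩ := exists_eq_insert he (F.plus_mem e he) (F.subset_plus e he)
  obtain ⟨y', -, rfl⟩ := exists_eq_insert he hTt heT
  obtain rfl : y = y' := (Finset.mem_insert.1 hy).resolve_right hye
  have hcy : c ≠ y := fun h => hne (h ▸ hc)
  have hct : insert c e ∈ 𝒯.triangles := hc ▸ F.plus_mem e he
  have hclt : inner ℝ (F.n e) (c - x) < 0 :=
    F.n_outward_lt he hx (hc ▸ Finset.mem_insert_self c e) hce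
  have hhull : hull e ∈ 𝓝[{p | inner ℝ (F.n e) (p - x) ≤ 0}] midpoint ℝ x b := by
    refine mem_of_superset (inter_mem (F.hull_insert_mem_nhdsWithin he hct hce hx hb hbx.symm hclt)
      (F.hull_insert_mem_nhdsWithin he hTt hye hx hb hbx.symm hlt))
      (𝒯.inter_hull_subset hct hTt fun p hpc hpy => ?_)
    exact (Finset.mem_insert.1 hpc).resolve_left fun h =>
      hce (h ▸ (Finset.mem_insert.1 hpy).resolve_left fun h' => hcy (h ▸ h'))
  exact hull_notMem_nhdsWithin_midpoint (F.norm_n e he) (F.n_perp e he x hx) hb hhull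

open Classical in
/-- The unit normal on the edge `e` that points out of the adjacent triangle `T`. -/
noncomputable def outer (T e : Finset Plane) : Plane :=
  if T = F.plus e then F.n e else -F.n e

theorem outer_plus (e : Finset Plane) : F.outer (F.plus e) e = F.n e := if_pos rfl

theorem outer_of_mem_minus {e T : Finset Plane} (hT : T ∈ F.minus e) : F.outer T e = -F.n e :=
  if_neg (F.mem_minus.1 hT).2.2

theorem edgeIntegral_jump {e : Finset Plane} {G : Finset Plane → Plane → ℝ}
    (hG : ∀ T, IntegrableOn (G T) (hull e) (Measure.hausdorffMeasure 1)) :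
    edgeIntegral e (F.jump G e) =
      edgeIntegral e (G (F.plus e)) - ∑ T ∈ F.minus e, edgeIntegral e (G T) := by
  simp only [edgeIntegral, jump]
  rw [integral_sub (hG _) (integrable_finsetSum _ fun T _ => hG T),
    integral_finsetSum _ fun T _ => hG T]

theorem filter_triangles_eq_insert [DecidableEq (Finset Plane)]
    [DecidableRel ((· ⊆ ·) : Finset Plane → Finset Plane → Prop)] {e : Finset Plane}
    (he : e ∈ 𝒯.edges) :
    {T ∈ 𝒯.triangles | e ⊆ T} = insert (F.plus e) (F.minus e) := by
  ext T
  have hplus : T = F.plus e → T ∈ 𝒯.triangles ∧ e ⊆ T := by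
    rintro rfl
    exact ⟨F.plus_mem e he, F.subset_plus e he⟩
  simp only [Finset.mem_filter, Finset.mem_insert, F.mem_minus]
  tauto

theorem sum_triangles_sum_edges (X : Finset Plane → Finset Plane → ℝ) :
    ∑ T ∈ 𝒯.triangles, ∑ e ∈ T.powersetCard 2, X T e =
      ∑ e ∈ 𝒯.edges, (X (F.plus e) e + ∑ T ∈ F.minus e, X T e) := by
  classical
  rw [Finset.sum_comm' (s := 𝒯.triangles) (t := fun T => T.powersetCard 2) (t' := 𝒯.edges)
    (s' := fun e => {T ∈ 𝒯.triangles | e ⊆ T})]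
  · refine Finset.sum_congr rfl fun e he => ?_
    rw [F.filter_triangles_eq_insert he, Finset.sum_insert (by simp [F.mem_minus])]
  · intro T e
    simp only [Finset.mem_filter]
    exact ⟨fun ⟨hT, he⟩ =>
        ⟨⟨hT, (Finset.mem_powersetCard.1 he).1⟩, 𝒯.mem_edges_of_subset hT he⟩,
      fun ⟨⟨hT, heT⟩, he⟩ =>
        ⟨hT, Finset.mem_powersetCard.2 ⟨heT, (𝒯.mem_edges.1 he).2⟩⟩⟩

theorem setIntegral_pd {T : Finset Plane} (hT : T ∈ 𝒯.triangles) {G : Plane → ℝ}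
    (hG : ContDiff ℝ 1 G) (i : Fin 2) :
    ∫ x in hull T, pd i G x =
      ∑ e ∈ T.powersetCard 2, F.outer T e i * edgeIntegral e G := by
  obtain ⟨hTf, hTcard⟩ := 𝒯.mem_triangles.1 hT
  have hmem {e : Finset Plane} (he : e ∈ T.powersetCard 2) : e ∈ 𝒯.edges :=
    𝒯.mem_edges_of_subset hT he
  have houter {e : Finset Plane} (he : e ∈ T.powersetCard 2) :
      T = F.plus e ∧ F.outer T e = F.n e ∨ T ∈ F.minus e ∧ F.outer T e = -F.n e := by
    by_cases hp : T = F.plus e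
    · exact Or.inl ⟨hp, if_pos hp⟩
    · exact Or.inr ⟨F.mem_minus.2 ⟨hT, (Finset.mem_powersetCard.1 he).1, hp⟩, if_neg hp⟩
  have h := setIntegral_hull_fderiv hTcard (𝒯.complex.indep hTf) (ν := F.outer T) ?_ ?_ ?_ hG
    (EuclideanSpace.single i 1)
  · simpa only [pd, EuclideanSpace.inner_single_right, one_mul, conj_trivial] using h
  · intro e he
    rcases houter he with ⟨-, h⟩ | ⟨-, h⟩ <;> simp only [h, norm_neg, F.norm_n e (hmem he)]
  · intro e he x hx y hy
    rcases houter he with ⟨-, h⟩ | ⟨-, h⟩ <;>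
      simp only [h, inner_neg_left, F.n_perp e (hmem he) x hx y hy, neg_zero]
  · intro e he x hx y hy
    rcases houter he with ⟨hp, h⟩ | ⟨hm, h⟩
    · exact h ▸ F.n_outward e (hmem he) x hx y (hp ▸ hy)
    · rw [h, inner_neg_left, neg_nonpos]
      exact F.n_inward (hmem he) hm hx hy

theorem sum_setIntegral_pd {G : Finset Plane → Plane → ℝ} (hG : ∀ T, ContDiff ℝ 1 (G T))
    (i : Fin 2) :
    ∑ T ∈ 𝒯.triangles, ∫ x in hull T, pd i (G T) x =
      ∑ e ∈ 𝒯.edges, F.n e i * edgeIntegral e (F.jump G e) := by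
  rw [Finset.sum_congr rfl fun T hT => F.setIntegral_pd hT (hG T) i, F.sum_triangles_sum_edges]
  refine Finset.sum_congr rfl fun e he => ?_
  have hminus : ∑ T ∈ F.minus e, F.outer T e i * edgeIntegral e (G T) =
      -(F.n e i * ∑ T ∈ F.minus e, edgeIntegral e (G T)) := by
    rw [Finset.mul_sum, ← Finset.sum_neg_distrib]
    refine Finset.sum_congr rfl fun T hT => ?_
    rw [F.outer_of_mem_minus hT, PiLp.neg_apply, neg_mul]
  rw [F.edgeIntegral_jump fun T =>
      integrableOn_hull_of_continuous (𝒯.mem_edges.1 he).2 (hG T).continuous,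
    hminus, outer_plus]
  ring

end EdgeFrame

/-! ### Green's formula -/

theorem contDiff_pd {φ : Plane → ℝ} (hφ : ContDiff ℝ ∞ φ) (i : Fin 2) : ContDiff ℝ ∞ (pd i φ) :=
  (hφ.fderiv_right (m := ∞) (by simp)).clm_apply contDiff_const

theorem pd_mul {f g : Plane → ℝ} (hf : Differentiable ℝ f) (hg : Differentiable ℝ g) (i : Fin 2)
    (x : Plane) : pd i (fun y => f y * g y) x = pd i f x * g x + f x * pd i g x := by
  simp only [pd, fderiv_fun_mul (hf x) (hg x), add_apply, smul_apply, smul_eq_mul]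
  ring

theorem pd_comm {φ : Plane → ℝ} (hφ : ContDiff ℝ ∞ φ) (i j : Fin 2) :
    pd i (pd j φ) = pd j (pd i φ) := by
  ext x
  have hd : DifferentiableAt ℝ (fderiv ℝ φ) x :=
    ((hφ.fderiv_right (m := ∞) (by simp)).differentiable (by simp)) x
  have h (v w : Plane) :
      fderiv ℝ (fun y => fderiv ℝ φ y v) x w = fderiv ℝ (fderiv ℝ φ) x w v := by
    simp [fderiv_clm_apply hd (differentiableAt_const v)]
  have hsymm : IsSymmSndFDerivAt ℝ φ x := hφ.contDiffAt.isSymmSndFDerivAt (by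
    rw [minSmoothness_of_isRCLikeNormedField]
    exact WithTop.coe_le_coe.2 (le_top : (2 : ℕ∞) ≤ ⊤))
  exact (h _ _).trans ((hsymm _ _).trans (h _ _).symm)

/-- The divergence of a differentiable vector field. -/
noncomputable def divergence (Φ : Fin 2 → Plane → ℝ) (x : Plane) : ℝ := ∑ i, pd i (Φ i) x

theorem continuous_divergence {Φ : Fin 2 → Plane → ℝ} (hΦ : ∀ i, ContDiff ℝ ∞ (Φ i)) :
    Continuous (divergence Φ) :=
  continuous_finsetSum _ fun i _ => (contDiff_pd (hΦ i) i).continuous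

/-- The volume terms `∫_A ∇g · q + ∫_A g r` of Green's formula for a vector field `q` with (weak)
divergence `r`. The terms are integrated separately, which makes them linear without any
integrability. -/
noncomputable def greenIntegral (A : Set Plane) (g : Plane → ℝ) (q : Fin 2 → Plane → ℝ)
    (r : Plane → ℝ) : ℝ :=
  (∑ i, ∫ x in A, pd i g x * q i x) + ∫ x in A, g x * r x

theorem sum_greenIntegral_pd_sub_greenIntegral (A : Set Plane) (g : Plane → ℝ)
    (M : Fin 2 → Fin 2 → Plane → ℝ) (q : Fin 2 → Plane → ℝ) (r : Plane → ℝ) :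
    ∑ i, greenIntegral A (pd i g) (M i) (q i) - greenIntegral A g q r =
      ∑ i, ∑ k, (∫ x in A, pd k (pd i g) x * M i k x) - ∫ x in A, g x * r x := by
  simp only [greenIntegral, Finset.sum_add_distrib]
  ring

theorem greenIntegral_divergence {A : Set Plane} {g : Plane → ℝ} {Φ : Fin 2 → Plane → ℝ}
    (hg : Differentiable ℝ g) (hΦ : ∀ i, Differentiable ℝ (Φ i))
    (hint : ∀ i, IntegrableOn (fun x => pd i g x * Φ i x) A)
    (hint' : ∀ i, IntegrableOn (fun x => g x * pd i (Φ i) x) A) :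
    greenIntegral A g Φ (divergence Φ) = ∑ i, ∫ x in A, pd i (fun y => g y * Φ i y) x := by
  simp only [greenIntegral, divergence, Finset.mul_sum]
  rw [integral_finsetSum _ fun i _ => hint' i, ← Finset.sum_add_distrib]
  refine Finset.sum_congr rfl fun i _ => ?_
  rw [← integral_add (hint i) (hint' i)]
  simp only [pd_mul hg (hΦ i)]

namespace EdgeFrame

variable {Ω : Set Plane} {𝒯 : Triangulation Ω} (F : EdgeFrame 𝒯)

theorem continuous_jump {P : Finset Plane → Plane → ℝ} (hP : ∀ T, Continuous (P T))
    (e : Finset Plane) : Continuous (F.jump P e) :=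
  (hP _).sub (continuous_finsetSum _ fun T _ => hP T)

theorem jump_mul_right (P : Finset Plane → Plane → ℝ) (g : Plane → ℝ) (e : Finset Plane)
    (x : Plane) : F.jump (fun T y => P T y * g y) e x = F.jump P e x * g x := by
  simp only [jump, sub_mul, Finset.sum_mul]

theorem sum_greenIntegral_divergence {P : Finset Plane → Plane → ℝ}
    (hP : ∀ T, ContDiff ℝ ∞ (P T)) {Φ : Fin 2 → Plane → ℝ} (hΦ : ∀ i, ContDiff ℝ ∞ (Φ i)) :
    ∑ T ∈ 𝒯.triangles, greenIntegral (hull T) (P T) Φ (divergence Φ) =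
      ∑ e ∈ 𝒯.edges, edgeIntegral e fun x => F.jump P e x * ∑ i, Φ i x * F.n e i := by
  have hPΦ (i T) : ContDiff ℝ ∞ fun y => P T y * Φ i y := (hP T).mul (hΦ i)
  have hvol (T) : greenIntegral (hull T) (P T) Φ (divergence Φ) =
      ∑ i, ∫ x in hull T, pd i (fun y => P T y * Φ i y) x :=
    greenIntegral_divergence ((hP T).differentiable (by simp))
      (fun i => (hΦ i).differentiable (by simp))
      (fun i => ((contDiff_pd (hP T) i).continuous.mul
        (hΦ i).continuous).continuousOn.integrableOn_compact (isCompact_hull T))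
      (fun i => ((hP T).continuous.mul
        (contDiff_pd (hΦ i) i).continuous).continuousOn.integrableOn_compact (isCompact_hull T))
  have hedge {e} (he : e ∈ 𝒯.edges) :
      (edgeIntegral e fun x => F.jump P e x * ∑ i, Φ i x * F.n e i) =
        ∑ i, F.n e i * edgeIntegral e (F.jump (fun T y => P T y * Φ i y) e) := by
    simp only [edgeIntegral, ← integral_const_mul]
    rw [← integral_finsetSum _ fun i _ =>
      (integrableOn_hull_of_continuous (𝒯.mem_edges.1 he).2
        (F.continuous_jump (fun T => (hPΦ i T).continuous) e)).const_mul _]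
    refine integral_congr_ae (ae_of_all _ fun x => ?_)
    simp only [F.jump_mul_right, Finset.mul_sum]
    exact Finset.sum_congr rfl fun i _ => by ring
  rw [Finset.sum_congr rfl fun T _ => hvol T, Finset.sum_congr rfl fun e he => hedge he,
    Finset.sum_comm, Finset.sum_comm (s := 𝒯.edges)]
  exact Finset.sum_congr rfl fun i _ =>
    F.sum_setIntegral_pd (fun T => (hPΦ i T).of_le (by exact_mod_cast le_top)) i

end EdgeFrame

theorem tendsto_setIntegral_continuousOn_mul {X ι : Type*} [TopologicalSpace X]
    [SecondCountableTopology X] [MeasurableSpace X] [OpensMeasurableSpace X] {μ : Measure X}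
    {l : Filter ι} {A K : Set X} {f : ι → X → ℝ} {f₀ g : X → ℝ} (hK : IsCompact K)
    (hA : MeasurableSet A) (hAK : A ⊆ K) (hg : ContinuousOn g K)
    (hf : ∀ m, IntegrableOn (f m) A μ) (hf₀ : IntegrableOn f₀ A μ)
    (hlim : Tendsto (fun m => ∫ x in A, |f m x - f₀ x| ∂μ) l (𝓝 0)) :
    Tendsto (fun m => ∫ x in A, g x * f m x ∂μ) l (𝓝 (∫ x in A, g x * f₀ x ∂μ)) := by
  obtain ⟨C, hC⟩ := hK.exists_bound_of_continuousOn hg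
  rw [tendsto_iff_norm_sub_tendsto_zero]
  refine squeeze_zero (fun _ => norm_nonneg _) (fun m => ?_) (by simpa using hlim.const_mul C)
  rw [← integral_sub ((hf m).continuousOn_mul_of_subset hg hK hA hAK)
    (hf₀.continuousOn_mul_of_subset hg hK hA hAK), ← integral_const_mul]
  refine norm_integral_le_of_norm_le (((hf m).sub hf₀).abs.const_mul C)
    (ae_restrict_of_forall_mem hA fun x hx => ?_)
  rw [← mul_sub, norm_mul]
  exact mul_le_mul_of_nonneg_right (hC x (hAK hx)) (abs_nonneg _)

/-- The smooth vector fields `Φ_m` and their divergences converge to `q` and `r` in `L¹(U)`. -/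
structure ConvergesWithDiv (U : Set Plane) (Φ : ℕ → Fin 2 → Plane → ℝ) (q : Fin 2 → Plane → ℝ)
    (r : Plane → ℝ) : Prop where
  contDiff : ∀ m i, ContDiff ℝ ∞ (Φ m i)
  integrableOn : ∀ i, IntegrableOn (q i) U
  integrableOn_div : IntegrableOn r U
  tendsto : ∀ i, Tendsto (fun m => ∫ x in U, |Φ m i x - q i x|) atTop (𝓝 0)
  tendsto_div : Tendsto (fun m => ∫ x in U, |divergence (Φ m) x - r x|) atTop (𝓝 0)

namespace ConvergesWithDiv

variable {A U K : Set Plane} {Φ : ℕ → Fin 2 → Plane → ℝ} {q : Fin 2 → Plane → ℝ} {r : Plane → ℝ}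

theorem mono (h : ConvergesWithDiv U Φ q r) (hAU : A ≤ᵐ[volume] U) (hK : IsCompact K)
    (hUK : U ⊆ K) : ConvergesWithDiv A Φ q r where
  contDiff := h.contDiff
  integrableOn i := (h.integrableOn i).mono_set_ae hAU
  integrableOn_div := h.integrableOn_div.mono_set_ae hAU
  tendsto i := squeeze_zero (fun _ => integral_nonneg fun _ => abs_nonneg _)
    (fun m => setIntegral_mono_set
      (((h.contDiff m i).continuous.continuousOn.integrableOn_compact hK).mono_set hUK |>.sub
        (h.integrableOn i)).abs (ae_of_all _ fun _ => abs_nonneg _) hAU) (h.tendsto i)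
  tendsto_div := squeeze_zero (fun _ => integral_nonneg fun _ => abs_nonneg _)
    (fun m => setIntegral_mono_set
      (((continuous_divergence (h.contDiff m)).continuousOn.integrableOn_compact hK).mono_set hUK
        |>.sub h.integrableOn_div).abs (ae_of_all _ fun _ => abs_nonneg _) hAU) h.tendsto_div

theorem tendsto_greenIntegral (h : ConvergesWithDiv A Φ q r) (hK : IsCompact K)
    (hA : MeasurableSet A) (hAK : A ⊆ K) {g : Plane → ℝ} (hg : ContDiff ℝ ∞ g) :
    Tendsto (fun m => greenIntegral A g (Φ m) (divergence (Φ m))) atTop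
      (𝓝 (greenIntegral A g q r)) := by
  have hcont {f : Plane → ℝ} (hf : Continuous f) : IntegrableOn f A :=
    (hf.continuousOn.integrableOn_compact hK).mono_set hAK
  refine (tendsto_finsetSum _ fun i _ => ?_).add ?_
  · exact tendsto_setIntegral_continuousOn_mul hK hA hAK (contDiff_pd hg i).continuous.continuousOn
      (fun m => hcont (h.contDiff m i).continuous) (h.integrableOn i) (h.tendsto i)
  · exact tendsto_setIntegral_continuousOn_mul hK hA hAK hg.continuous.continuousOn
      (fun m => hcont (continuous_divergence (h.contDiff m))) h.integrableOn_div h.tendsto_div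

end ConvergesWithDiv

theorem HasNormalTrace.sum_greenIntegral {Ω : Set Plane} {𝒯 : Triangulation Ω} (F : EdgeFrame 𝒯)
    {c j : Finset Plane → Plane → ℝ} {q : Fin 2 → Plane → ℝ} {r : Plane → ℝ}
    {ψ : Finset Plane → Plane → ℝ} (h : HasNormalTrace Ω 𝒯.edges F.n j q r ψ)
    (hj : ∀ e, Continuous (j e)) (hc : ∀ e, Continuous (c e)) {P : Finset Plane → Plane → ℝ}
    (hP : ∀ T, ContDiff ℝ ∞ (P T)) (hPj : ∀ e x, F.jump P e x = c e x * j e x) :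
    ∑ T ∈ 𝒯.triangles, greenIntegral (hull T) (P T) q r =
      ∑ e ∈ 𝒯.edges, edgeIntegral e fun x => F.jump P e x * ψ e x := by
  obtain ⟨hq, hr, hψ, Φ, hΦ, hlim, hlim_div, hlim_edge⟩ := h
  have hconv : ConvergesWithDiv Ω Φ q r := ⟨hΦ, hq, hr, hlim, hlim_div⟩
  have hvol : Tendsto (fun m => ∑ T ∈ 𝒯.triangles,
      greenIntegral (hull T) (P T) (Φ m) (divergence (Φ m))) atTop
      (𝓝 (∑ T ∈ 𝒯.triangles, greenIntegral (hull T) (P T) q r)) :=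
    tendsto_finsetSum _ fun T hT =>
      (hconv.mono (𝒯.hull_ae_le_domain hT) 𝒯.isCompact_space
        𝒯.domain_subset_space).tendsto_greenIntegral (isCompact_hull T)
        (isCompact_hull T).measurableSet subset_rfl (hP T)
  simp_rw [F.sum_greenIntegral_divergence hP (hΦ _)] at hvol
  refine tendsto_nhds_unique hvol (tendsto_finsetSum _ fun e he => ?_)
  simp only [hPj, mul_assoc, edgeIntegral]
  refine tendsto_setIntegral_continuousOn_mul (isCompact_hull e) (isCompact_hull e).measurableSet
    subset_rfl (hc e).continuousOn (fun m => ?_) (hψ e he) ?_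
  · exact integrableOn_hull_of_continuous (𝒯.mem_edges.1 he).2 ((hj e).mul
      (continuous_finsetSum _ fun i _ => (hΦ m i).continuous.mul continuous_const))
  · simpa only [edgeIntegral, ← mul_sub, abs_mul] using hlim_edge e he

/-! ### The strong form of the dual equation -/

/-- The test functions `φ ∈ C_c^∞(U)`. -/
structure IsTestFunction (U : Set Plane) (φ : Plane → ℝ) : Prop where
  contDiff : ContDiff ℝ ∞ φ
  hasCompactSupport : HasCompactSupport φ
  tsupport_subset : tsupport φ ⊆ U

namespace IsTestFunction

variable {U : Set Plane} {φ : Plane → ℝ}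

theorem pderiv (hφ : IsTestFunction U φ) (i : Fin 2) : IsTestFunction U (pd i φ) where
  contDiff := contDiff_pd hφ.contDiff i
  hasCompactSupport := hφ.hasCompactSupport.fderiv_apply ℝ _
  tsupport_subset := (tsupport_fderiv_apply_subset ℝ _).trans hφ.tsupport_subset

theorem mul_right (hφ : IsTestFunction U φ) {ψ : Plane → ℝ} (hψ : ContDiff ℝ ∞ ψ) :
    IsTestFunction U fun x => φ x * ψ x where
  contDiff := hφ.contDiff.mul hψ
  hasCompactSupport := hφ.hasCompactSupport.mul_right
  tsupport_subset := (tsupport_mul_subset_left (f := φ) (g := ψ)).trans hφ.tsupport_subset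

theorem integrable (hφ : IsTestFunction U φ) : Integrable φ :=
  hφ.contDiff.continuous.integrable_of_hasCompactSupport hφ.hasCompactSupport

theorem memLp (hφ : IsTestFunction U φ) : MemLp φ 2 (volume.restrict U) :=
  hφ.contDiff.continuous.memLp_of_hasCompactSupport hφ.hasCompactSupport

theorem setIntegral_mul (hφ : IsTestFunction U φ) (f : Plane → ℝ) :
    ∫ x in U, φ x * f x = ∫ x, φ x * f x :=
  setIntegral_eq_integral_of_forall_compl_eq_zero fun x hx => by
    rw [image_eq_zero_of_notMem_tsupport fun h => hx (hφ.tsupport_subset h), zero_mul]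

theorem setIntegral_pd (hφ : IsTestFunction U φ) (i : Fin 2) :
    ∫ x in U, pd i φ x = 0 := by
  have hplane : ∫ x in U, pd i φ x = ∫ x, pd i φ x := by
    simpa using (hφ.pderiv i).setIntegral_mul fun _ => 1
  have hparts := integral_mul_fderiv_eq_neg_fderiv_mul_of_integrable (μ := volume)
    (f := fun _ => (1 : ℝ)) (g := φ) (v := EuclideanSpace.single i 1) (by simp)
    ((hφ.pderiv i).integrable.const_mul 1) (hφ.integrable.const_mul 1)
    (fun _ _ => differentiableAt_const _) (fun x _ => hφ.contDiff.differentiable (by simp) x)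
  rw [hplane]
  simpa [pd] using hparts

theorem exists_H20 (hφ : IsTestFunction U φ) :
    ∃ v : H20 U, fnOf v =ᵐ[volume.restrict U] φ ∧
      ∀ i j, D2 v i j =ᵐ[volume.restrict U] pd i (pd j φ) := by
  let x : Jet U := (hφ.memLp.toLp, fun i => (hφ.pderiv i).memLp.toLp,
    fun i j => ((hφ.pderiv j).pderiv i).memLp.toLp)
  have hx : IsTestJet U x := ⟨φ, hφ.contDiff, hφ.hasCompactSupport, hφ.tsupport_subset,
    hφ.memLp.coeFn_toLp, fun i => (hφ.pderiv i).memLp.coeFn_toLp,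
    fun i j => ((hφ.pderiv j).pderiv i).memLp.coeFn_toLp⟩
  exact ⟨⟨x, Submodule.le_topologicalClosure _ (Submodule.subset_span hx)⟩,
    hφ.memLp.coeFn_toLp, fun i j => ((hφ.pderiv j).pderiv i).memLp.coeFn_toLp⟩

end IsTestFunction

/-- `r` is the distributional divergence of the vector field `q` on `U`. -/
def HasWeakDiv (U : Set Plane) (q : Fin 2 → Plane → ℝ) (r : Plane → ℝ) : Prop :=
  ∀ φ, IsTestFunction U φ → greenIntegral U φ q r = 0

theorem ConvergesWithDiv.hasWeakDiv {U K : Set Plane} {Φ : ℕ → Fin 2 → Plane → ℝ}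
    {q : Fin 2 → Plane → ℝ} {r : Plane → ℝ} (h : ConvergesWithDiv U Φ q r)
    (hU : MeasurableSet U) (hK : IsCompact K) (hUK : U ⊆ K) : HasWeakDiv U q r := by
  intro φ hφ
  refine tendsto_nhds_unique (h.tendsto_greenIntegral hK hU hUK hφ.contDiff)
    (tendsto_const_nhds.congr fun m => Eq.symm ?_)
  rw [greenIntegral_divergence (hφ.contDiff.differentiable (by simp))
    fun i => (h.contDiff m i).differentiable (by simp)]
  · exact Finset.sum_eq_zero fun i _ => (hφ.mul_right (h.contDiff m i)).setIntegral_pd i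
  · exact fun i => ((hφ.pderiv i).mul_right (h.contDiff m i)).integrable.integrableOn
  · exact fun i => (hφ.mul_right (contDiff_pd (h.contDiff m i) i)).integrable.integrableOn

theorem HasNormalTrace.hasWeakDiv {Ω : Set Plane} (𝒯 : Triangulation Ω)
    {s : Finset (Finset Plane)} {n : Finset Plane → Plane} {j : Finset Plane → Plane → ℝ}
    {q : Fin 2 → Plane → ℝ} {r : Plane → ℝ} {ψ : Finset Plane → Plane → ℝ}
    (h : HasNormalTrace Ω s n j q r ψ) : HasWeakDiv Ω q r := by
  obtain ⟨hq, hr, -, Φ, hΦ, hlim, hlim_div, -⟩ := h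
  exact ConvergesWithDiv.hasWeakDiv ⟨hΦ, hq, hr, hlim, hlim_div⟩
    𝒯.isOpen_domain.measurableSet 𝒯.isCompact_space 𝒯.domain_subset_space

theorem HasWeakDiv.sum_setIntegral_pd_pd {U : Set Plane} {M : Fin 2 → Fin 2 → Plane → ℝ}
    {q : Fin 2 → Plane → ℝ} {r : Plane → ℝ} (hM : ∀ i, HasWeakDiv U (M i) (q i))
    (hq : HasWeakDiv U q r) {φ : Plane → ℝ} (hφ : IsTestFunction U φ) :
    ∑ i, ∑ k, ∫ x in U, pd k (pd i φ) x * M i k x = ∫ x in U, φ x * r x := by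
  have h := sum_greenIntegral_pd_sub_greenIntegral U φ M q r
  rw [Finset.sum_eq_zero fun i _ => hM i _ (hφ.pderiv i), hq φ hφ, sub_zero] at h
  exact (sub_eq_zero.1 h.symm)

section tensorIntegral

variable {A : Set Plane} {p p' q q' : Fin 2 → Fin 2 → Plane → ℝ}

theorem integrableOn_tensor_mul (hp : ∀ i j, MemLp (p i j) 2 (volume.restrict A))
    (hq : ∀ i j, MemLp (q i j) 2 (volume.restrict A)) :
    IntegrableOn (fun x => ∑ i, ∑ j, p i j x * q i j x) A :=
  integrable_finsetSum _ fun i _ => integrable_finsetSum _ fun j _ =>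
    (hp i j).integrable_mul (hq i j)

theorem tensorIntegral_eq_sum (hp : ∀ i j, MemLp (p i j) 2 (volume.restrict A))
    (hq : ∀ i j, MemLp (q i j) 2 (volume.restrict A)) :
    tensorIntegral A p q = ∑ i, ∑ j, ∫ x in A, p i j x * q i j x := by
  have hint (i j) : IntegrableOn (fun x => p i j x * q i j x) A := (hp i j).integrable_mul (hq i j)
  rw [tensorIntegral, integral_finsetSum _ fun i _ => integrable_finsetSum _ fun j _ => hint i j]
  exact Finset.sum_congr rfl fun i _ => integral_finsetSum _ fun j _ => hint i j

theorem tensorIntegral_comm (A : Set Plane) (p q : Fin 2 → Fin 2 → Plane → ℝ) :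
    tensorIntegral A p q = tensorIntegral A q p := by
  simp only [tensorIntegral, mul_comm]

theorem tensorIntegral_sub_left (hp : ∀ i j, MemLp (p i j) 2 (volume.restrict A))
    (hp' : ∀ i j, MemLp (p' i j) 2 (volume.restrict A))
    (hq : ∀ i j, MemLp (q i j) 2 (volume.restrict A)) :
    tensorIntegral A (p - p') q = tensorIntegral A p q - tensorIntegral A p' q := by
  simp only [tensorIntegral, Pi.sub_apply, sub_mul, Finset.sum_sub_distrib]
  exact integral_sub (integrableOn_tensor_mul hp hq) (integrableOn_tensor_mul hp' hq)

theorem tensorIntegral_sub_right (hp : ∀ i j, MemLp (p i j) 2 (volume.restrict A))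
    (hq : ∀ i j, MemLp (q i j) 2 (volume.restrict A))
    (hq' : ∀ i j, MemLp (q' i j) 2 (volume.restrict A)) :
    tensorIntegral A p (q - q') = tensorIntegral A p q - tensorIntegral A p q' := by
  simp only [tensorIntegral_comm A p, tensorIntegral_sub_left hq hq' hp]

end tensorIntegral

theorem Tensor.memLp_fn {Ω A : Set Plane} (σ : Tensor Ω) (hA : A ≤ᵐ[volume] Ω) (i j : Fin 2) :
    MemLp (σ.fn i j) 2 (volume.restrict A) :=
  (Lp.memLp (σ i j)).mono_measure (Measure.restrict_mono_ae hA)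

namespace IsDualSolution

variable {Ω : Set Plane} {ft : L2 Ω} {ut : H20 Ω}

theorem sum_setIntegral_pd_pd (hut : IsDualSolution ft ut) {φ : Plane → ℝ}
    (hφ : IsTestFunction Ω φ) :
    ∑ i, ∑ k, ∫ x in Ω, pd k (pd i φ) x * D2 ut i k x = ∫ x in Ω, φ x * ft x := by
  obtain ⟨v, hv, hD2v⟩ := hφ.exists_H20
  have h := hut v
  rw [tensorIntegral_comm, tensorIntegral_eq_sum ((D2 v).memLp_fn .rfl)
    ((D2 ut).memLp_fn .rfl)] at h
  calc ∑ i, ∑ k, ∫ x in Ω, pd k (pd i φ) x * D2 ut i k x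
      = ∑ i, ∑ k, ∫ x in Ω, (D2 v).fn i k x * (D2 ut).fn i k x := by
        refine Finset.sum_congr rfl fun i _ => Finset.sum_congr rfl fun k _ =>
          integral_congr_ae ((hD2v i k).mono fun x hx => ?_)
        simp only [Tensor.fn, hx, pd_comm hφ.contDiff k i]
    _ = ∫ x in Ω, φ x * ft x := h.trans (integral_congr_ae (hv.mono fun x hx => by
        simp only [hx, mul_comm]))

theorem ae_eq (hut : IsDualSolution ft ut) (hΩ : IsOpen Ω) {q : Fin 2 → Plane → ℝ}
    {r : Plane → ℝ} (hM : ∀ i, HasWeakDiv Ω ((D2 ut).fn i) (q i)) (hq : HasWeakDiv Ω q r)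
    (hr : IntegrableOn r Ω) : ft =ᵐ[volume.restrict Ω] r := by
  have hloc : LocallyIntegrableOn (fun x => ft x - r x) Ω :=
    (locallyIntegrableOn_of_locallyIntegrable_restrict
      ((Lp.memLp ft).locallyIntegrable (by norm_num))).sub hr.locallyIntegrableOn
  have hweak (φ : Plane → ℝ) (hφ : IsTestFunction Ω φ) : ∫ x, φ x • (ft x - r x) = 0 := by
    obtain ⟨C, hC⟩ := hφ.hasCompactSupport.exists_bound_of_continuous hφ.contDiff.continuous
    have hφr : IntegrableOn (fun x => φ x * r x) Ω :=
      hr.bdd_mul hφ.contDiff.continuous.aestronglyMeasurable (ae_of_all _ hC)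
    have hφft : IntegrableOn (fun x => φ x * ft x) Ω := hφ.memLp.integrable_mul (Lp.memLp ft)
    simp only [smul_eq_mul]
    rw [← hφ.setIntegral_mul]
    simp only [mul_sub]
    rw [integral_sub hφft hφr, ← hut.sum_setIntegral_pd_pd hφ,
      ← HasWeakDiv.sum_setIntegral_pd_pd hM hq hφ]
    exact sub_self _
  have h := hΩ.ae_eq_zero_of_integral_contDiff_smul_eq_zero hloc
    fun φ hφ hc hs => hweak φ ⟨hφ, hc, hs⟩
  exact (ae_restrict_iff' hΩ.measurableSet).2 (h.mono fun x hx hxΩ => sub_eq_zero.1 (hx hxΩ))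

end IsDualSolution

/-! ### Piecewise polynomials -/

theorem contDiff_eval (p : MvPolynomial (Fin 2) ℝ) :
    ContDiff ℝ ∞ fun x : Plane => MvPolynomial.eval (fun i => x i) p := by
  induction p using MvPolynomial.induction_on with
  | C a => simpa using contDiff_const
  | add p q hp hq => simpa using hp.add hq
  | mul_X p i hp => simpa using hp.mul (EuclideanSpace.proj i : Plane →L[ℝ] ℝ).contDiff

theorem pd_coord (i j : Fin 2) (x : Plane) :
    pd i (fun y : Plane => y j) x = Pi.single (M := fun _ => ℝ) i 1 j := by
  have h : HasFDerivAt (fun y : Plane => y j) (EuclideanSpace.proj j : Plane →L[ℝ] ℝ) x :=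
    (EuclideanSpace.proj j : Plane →L[ℝ] ℝ).hasFDerivAt
  simp [pd, h.fderiv, Pi.single_apply]

theorem pd_eval (p : MvPolynomial (Fin 2) ℝ) (i : Fin 2) :
    pd i (fun y : Plane => MvPolynomial.eval (fun j => y j) p) =
      fun x => MvPolynomial.eval (fun j => x j) (MvPolynomial.pderiv i p) := by
  ext x
  have hdiff (p : MvPolynomial (Fin 2) ℝ) :
      Differentiable ℝ fun y : Plane => MvPolynomial.eval (fun j => y j) p :=
    (contDiff_eval p).differentiable (by simp)
  induction p using MvPolynomial.induction_on with
  | C a => simp [pd]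
  | add p q hp hq =>
    simp only [pd] at hp hq ⊢
    simp only [map_add, fderiv_fun_add (hdiff p x) (hdiff q x), add_apply, hp, hq]
  | mul_X p j hp =>
    have hX : Differentiable ℝ fun y : Plane => y j := by simpa using hdiff (.X j)
    simp only [map_mul, MvPolynomial.eval_X, MvPolynomial.pderiv_mul, map_add,
      pd_mul (hdiff p) hX, hp, pd_coord, MvPolynomial.pderiv_X]
    by_cases hij : j = i
    · subst hij; simp
    · simp [hij]

namespace BrokenPoly

variable {Ω : Set Plane} {𝒯 : Triangulation Ω} {k : ℕ} (v : BrokenPoly 𝒯 k)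

theorem contDiff_val (T : Finset Plane) : ContDiff ℝ ∞ (v.val T) := contDiff_eval _

theorem contDiff_grad (i : Fin 2) (T : Finset Plane) : ContDiff ℝ ∞ (v.grad i T) :=
  contDiff_eval _

theorem pd_val (i : Fin 2) (T : Finset Plane) : pd i (v.val T) = v.grad i T := pd_eval _ _

theorem pd_pd_val (i j : Fin 2) (T : Finset Plane) :
    pd j (pd i (v.val T)) = v.hess T i j := by
  rw [pd_comm (v.contDiff_val T), pd_val]
  exact pd_eval _ _

theorem memLp_hess (T : Finset Plane) (i j : Fin 2) :
    MemLp (v.hess T i j) 2 (volume.restrict (hull T)) :=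
  have hcont : Continuous (v.hess T i j) := (contDiff_eval _).continuous
  (memLp_two_iff_integrable_sq hcont.aestronglyMeasurable).2
    ((hcont.pow 2).continuousOn.integrableOn_compact (isCompact_hull T))

theorem jump_directional (F : EdgeFrame 𝒯) (a : Plane) (e : Finset Plane) (x : Plane) :
    F.jump (fun T y => ∑ i, v.grad i T y * a i) e x = ∑ i, F.jump (v.grad i) e x * a i := by
  simp only [EdgeFrame.jump, Fin.sum_univ_two, Finset.sum_add_distrib, ← Finset.sum_mul]
  ring

end BrokenPoly

theorem EdgeFrame.sum_mul_eq {Ω : Set Plane} {𝒯 : Triangulation Ω} (F : EdgeFrame 𝒯)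
    {e : Finset Plane} (he : e ∈ 𝒯.edges) (a b : Fin 2 → ℝ) :
    ∑ i, a i * b i = (∑ i, a i * F.τ e i) * (∑ i, F.τ e i * b i) +
      (∑ i, a i * F.n e i) * ∑ i, F.n e i * b i := by
  have hframe : Orthonormal ℝ ![F.τ e, F.n e] := by
    simp [F.norm_n e he, F.norm_τ e he, real_inner_comm, F.τ_perp e he]
  have hspan := hframe.linearIndependent.span_eq_top_of_card_eq_finrank (by simp)
  have h := (OrthonormalBasis.mk hframe hspan.ge).sum_inner_mul_inner
    (WithLp.toLp 2 a : Plane) (WithLp.toLp 2 b)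
  simp only [OrthonormalBasis.coe_mk, PiLp.inner_apply, RCLike.inner_apply, conj_trivial,
    Fin.sum_univ_two, Matrix.cons_val] at h
  simp only [Fin.sum_univ_two]
  linarith

namespace EdgeTraces

variable {Ω : Set Plane} {𝒯 : Triangulation Ω}

instance : Sub EdgeTraces := ⟨fun S S' => ⟨S.vec - S'.vec, S.div - S'.div⟩⟩

/-- The traces `vec e` are integrable on the edges `e ∈ s`, and `div e` is so with weight `j e`. -/
structure IsIntegrable (S : EdgeTraces) (s : Finset (Finset Plane))
    (j : Finset Plane → Plane → ℝ) : Prop where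
  vec : ∀ e ∈ s, ∀ i, IntegrableOn (S.vec e i) (hull e) (Measure.hausdorffMeasure 1)
  div : ∀ e ∈ s, IntegrableOn (fun x => j e x * S.div e x) (hull e) (Measure.hausdorffMeasure 1)

theorem IsIntegrable.sub {S S' : EdgeTraces} {s : Finset (Finset Plane)}
    {j : Finset Plane → Plane → ℝ} (hS : S.IsIntegrable s j) (hS' : S'.IsIntegrable s j) :
    (S - S').IsIntegrable s j where
  vec e he i := (hS.vec e he i).sub (hS'.vec e he i)
  div e he := ((hS.div e he).sub (hS'.div e he)).congr
    (ae_of_all _ fun _ => (mul_sub _ _ _).symm)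

theorem nn_sub (S S' : EdgeTraces) (F : EdgeFrame 𝒯) (e : Finset Plane) (x : Plane) :
    (S - S').nn F e x = S.nn F e x - S'.nn F e x := by
  simp only [nn, ← Finset.sum_sub_distrib, ← mul_sub]
  rfl

theorem nτ_sub (S S' : EdgeTraces) (F : EdgeFrame 𝒯) (e : Finset Plane) (x : Plane) :
    (S - S').nτ F e x = S.nτ F e x - S'.nτ F e x := by
  simp only [nτ, ← Finset.sum_sub_distrib, ← mul_sub]
  rfl

theorem div_sub (S S' : EdgeTraces) (e : Finset Plane) (x : Plane) :
    (S - S').div e x = S.div e x - S'.div e x := rfl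

end EdgeTraces

theorem HasMomentTrace.isIntegrable {U : Set Plane} {s : Finset (Finset Plane)}
    {n : Finset Plane → Plane} {j : Finset Plane → Plane → ℝ} {M : Fin 2 → Fin 2 → Plane → ℝ}
    {t : EdgeTraces} (h : HasMomentTrace U s n j M t.vec t.div) : t.IsIntegrable s j := by
  obtain ⟨_, _, hM, -, -, hdiv, -⟩ := h
  exact ⟨fun e he i => by simpa using (hM i).2.2.1 e he, hdiv⟩

namespace BrokenPoly

variable {Ω : Set Plane} {𝒯 : Triangulation Ω} {k : ℕ}

/-- The edge terms `∑_e ∫_e [∂_τ v] S_nτ + ∑_e ∫_e [∂_n v] S_nn - ∑_e ∫_e [v] (div S · n_e)` of the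
estimator, for a piecewise polynomial `v` and the traces `S` of a tensor. -/
noncomputable def edgePairing (v : BrokenPoly 𝒯 k) (F : EdgeFrame 𝒯) (S : EdgeTraces) : ℝ :=
  ∑ e ∈ 𝒯.edges, edgeIntegral e (fun x => v.jumpT F e x * S.nτ F e x)
    + ∑ e ∈ 𝒯.edges, edgeIntegral e (fun x => v.jumpN F e x * S.nn F e x)
    - ∑ e ∈ 𝒯.edges, edgeIntegral e (fun x => v.jump F e x * S.div e x)

variable (v : BrokenPoly 𝒯 k) (F : EdgeFrame 𝒯)

theorem continuous_jump_grad (i : Fin 2) (e : Finset Plane) :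
    Continuous (F.jump (v.grad i) e) :=
  F.continuous_jump (fun T => (v.contDiff_grad i T).continuous) e

theorem integrableOn_jump_grad_mul {e : Finset Plane} {g : Plane → ℝ} (i : Fin 2)
    (hg : IntegrableOn g (hull e) (Measure.hausdorffMeasure 1)) :
    IntegrableOn (fun x => F.jump (v.grad i) e x * g x) (hull e) (Measure.hausdorffMeasure 1) :=
  hg.continuousOn_mul (v.continuous_jump_grad F i e).continuousOn (isCompact_hull e)

theorem edgeIntegral_jumpT_add_jumpN {S : EdgeTraces} {e : Finset Plane} (he : e ∈ 𝒯.edges)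
    (hS : ∀ i, IntegrableOn (S.vec e i) (hull e) (Measure.hausdorffMeasure 1)) :
    edgeIntegral e (fun x => v.jumpT F e x * S.nτ F e x) +
        edgeIntegral e (fun x => v.jumpN F e x * S.nn F e x) =
      ∑ i, edgeIntegral e fun x => F.jump (v.grad i) e x * S.vec e i x := by
  have hint (a : Plane) : IntegrableOn (fun x => (∑ i, F.jump (v.grad i) e x * a i) *
      ∑ i, a i * S.vec e i x) (hull e) (Measure.hausdorffMeasure 1) :=
    IntegrableOn.continuousOn_mul (continuous_finsetSum _ fun i _ =>
      (v.continuous_jump_grad F i e).mul continuous_const).continuousOn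
      (integrable_finsetSum _ fun i _ => (hS i).const_mul (a i)) (isCompact_hull e)
  simp only [edgeIntegral, jumpT, jumpN, v.jump_directional, EdgeTraces.nτ, EdgeTraces.nn]
  rw [← integral_add (hint _) (hint _),
    ← integral_finsetSum _ fun i _ => v.integrableOn_jump_grad_mul F i (hS i)]
  exact integral_congr_ae (ae_of_all _ fun x => (F.sum_mul_eq he _ _).symm)

theorem edgePairing_eq {S : EdgeTraces} (hS : S.IsIntegrable 𝒯.edges (v.jump F)) :
    v.edgePairing F S =
      ∑ i, ∑ e ∈ 𝒯.edges, edgeIntegral e (fun x => F.jump (v.grad i) e x * S.vec e i x)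
        - ∑ e ∈ 𝒯.edges, edgeIntegral e (fun x => v.jump F e x * S.div e x) := by
  rw [edgePairing, ← Finset.sum_add_distrib, Finset.sum_comm,
    Finset.sum_congr rfl fun e he => v.edgeIntegral_jumpT_add_jumpN F he (hS.vec e he)]

theorem edgePairing_sub {S S' : EdgeTraces} (hS : S.IsIntegrable 𝒯.edges (v.jump F))
    (hS' : S'.IsIntegrable 𝒯.edges (v.jump F)) :
    v.edgePairing F (S - S') = v.edgePairing F S - v.edgePairing F S' := by
  have hvec (i) {e} (he : e ∈ 𝒯.edges) :
      edgeIntegral e (fun x => F.jump (v.grad i) e x * (S - S').vec e i x) =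
        edgeIntegral e (fun x => F.jump (v.grad i) e x * S.vec e i x) -
          edgeIntegral e (fun x => F.jump (v.grad i) e x * S'.vec e i x) := by
    simp only [edgeIntegral]
    rw [← integral_sub (v.integrableOn_jump_grad_mul F i (hS.vec e he i))
      (v.integrableOn_jump_grad_mul F i (hS'.vec e he i))]
    simp only [← mul_sub]
    rfl
  have hdiv {e} (he : e ∈ 𝒯.edges) :
      edgeIntegral e (fun x => v.jump F e x * (S - S').div e x) =
        edgeIntegral e (fun x => v.jump F e x * S.div e x) -
          edgeIntegral e (fun x => v.jump F e x * S'.div e x) := by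
    simp only [edgeIntegral]
    rw [← integral_sub (hS.div e he) (hS'.div e he)]
    simp only [EdgeTraces.div_sub, mul_sub]
  rw [v.edgePairing_eq F (hS.sub hS'), v.edgePairing_eq F hS, v.edgePairing_eq F hS',
    Finset.sum_congr rfl fun i _ => Finset.sum_congr rfl fun e he => hvec i he,
    Finset.sum_congr rfl fun e he => hdiv he]
  simp only [Finset.sum_sub_distrib]
  ring

theorem tensorIntegral_hess {T : Finset Plane} {σ : Tensor Ω} (hT : T ∈ 𝒯.triangles) :
    tensorIntegral (hull T) (v.hess T) σ.fn =
      ∑ i, ∑ j, ∫ x in hull T, pd j (pd i (v.val T)) x * σ i j x := by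
  simp only [v.pd_pd_val]
  exact tensorIntegral_eq_sum (v.memLp_hess T) (σ.memLp_fn (𝒯.hull_ae_le_domain hT))

theorem goal_eq {ft : L2 Ω} {r : Plane → ℝ} (hr : ft =ᵐ[volume.restrict Ω] r) :
    goal ft v.toL2 = ∑ T ∈ 𝒯.triangles, ∫ x in hull T, v.val T x * r x := by
  have hint : IntegrableOn (fun x => ft x * v.toL2 x) Ω :=
    (Lp.memLp ft).integrable_mul (Lp.memLp v.toL2)
  rw [goal, 𝒯.setIntegral_domain hint]
  refine Finset.sum_congr rfl fun T hT => integral_congr_ae ?_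
  filter_upwards [v.ae_eq T hT, ae_mono (Measure.restrict_mono_ae (𝒯.hull_ae_le_domain hT)) hr]
    with x hv hft
  rw [hv, hft, mul_comm, val]

theorem goal_eq_sub_edgePairing {ft : L2 Ω} {ut : H20 Ω} (hut : IsDualSolution ft ut)
    {D : EdgeTraces} (hD : HasMomentTrace Ω 𝒯.edges F.n (v.jump F) (D2 ut).fn D.vec D.div) :
    goal ft v.toL2 = ∑ T ∈ 𝒯.triangles, tensorIntegral (hull T) (v.hess T) (D2 ut).fn -
      v.edgePairing F D := by
  have hDint := hD.isIntegrable
  obtain ⟨q, r, hM, hq⟩ := hD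
  have hr : ft =ᵐ[volume.restrict Ω] r := hut.ae_eq 𝒯.isOpen_domain
    (fun i => (hM i).hasWeakDiv 𝒯) (hq.hasWeakDiv 𝒯) hq.2.1
  have hgrad (i) : ∑ T ∈ 𝒯.triangles, greenIntegral (hull T) (v.grad i T) ((D2 ut).fn i) (q i) =
      ∑ e ∈ 𝒯.edges, edgeIntegral e fun x => F.jump (v.grad i) e x * D.vec e i x :=
    (hM i).sum_greenIntegral F (fun _ => continuous_const) (v.continuous_jump_grad F i)
      (v.contDiff_grad i) fun _ _ => (mul_one _).symm
  have hval : ∑ T ∈ 𝒯.triangles, greenIntegral (hull T) (v.val T) q r =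
      ∑ e ∈ 𝒯.edges, edgeIntegral e fun x => v.jump F e x * D.div e x :=
    hq.sum_greenIntegral F (F.continuous_jump fun T => (v.contDiff_val T).continuous)
      (fun _ => continuous_const) v.contDiff_val fun _ _ => (one_mul _).symm
  rw [v.goal_eq hr, v.edgePairing_eq F hDint, ← hval,
    Finset.sum_congr rfl fun i _ => (hgrad i).symm, Finset.sum_comm,
    ← Finset.sum_sub_distrib, ← Finset.sum_sub_distrib]
  refine Finset.sum_congr rfl fun T hT => ?_
  have h := sum_greenIntegral_pd_sub_greenIntegral (hull T) (v.val T) (D2 ut).fn q r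
  simp only [v.pd_val] at h
  rw [h, v.tensorIntegral_hess hT]
  simp [Tensor.fn, v.pd_val]

end BrokenPoly

/-! ### The error identity -/

namespace EdgeFrame

variable {Ω : Set Plane} {𝒯 : Triangulation Ω} (F : EdgeFrame 𝒯)

theorem mul_edgeValue (w : ℝ) (g : Plane → ℝ) (φ : Finset Plane → Plane → ℝ)
    (e : Finset Plane) (x : Plane) :
    g x * F.edgeValue w φ e x = F.edgeValue w (fun T y => g y * φ T y) e x := by
  simp only [edgeValue, ← mul_sub, ← Finset.mul_sum]
  ring

theorem integrableOn_edgeValue {φ : Finset Plane → Plane → ℝ} {e : Finset Plane}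
    {μ : Measure Plane} {A : Set Plane} (w : ℝ) (he : e ∈ 𝒯.edges)
    (h : ∀ T ∈ 𝒯.triangles, e ⊆ T → IntegrableOn (φ T) A μ) :
    IntegrableOn (F.edgeValue w φ e) A μ := by
  have hplus := h _ (F.plus_mem e he) (F.subset_plus e he)
  have hminus (T) (hT : T ∈ F.minus e) := h T (F.mem_minus.1 hT).1 (F.mem_minus.1 hT).2.1
  exact hplus.sub ((integrable_finsetSum _ fun T hT => hplus.sub (hminus T hT)).const_mul w)

end EdgeFrame

theorem EdgeTraces.IsIntegrable.glue {Ω : Set Plane} {𝒯 : Triangulation Ω} (F : EdgeFrame 𝒯)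
    (w : Finset Plane → ℝ) {j : Finset Plane → Plane → ℝ} {t : Finset Plane → EdgeTraces}
    (ht : ∀ T ∈ 𝒯.triangles, (t T).IsIntegrable (𝒯.edgesOf T) j) :
    (EdgeTraces.glue F w t).IsIntegrable 𝒯.edges j where
  vec e he i := F.integrableOn_edgeValue (w e) he fun T hT heT =>
    (ht T hT).vec e (Finset.mem_filter.2 ⟨he, heT⟩) i
  div e he := by
    simp only [EdgeTraces.glue, F.mul_edgeValue]
    exact F.integrableOn_edgeValue (w e) he fun T hT heT =>
      (ht T hT).div e (Finset.mem_filter.2 ⟨he, heT⟩)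

variable {Ω : Set Plane} {𝒯 : Triangulation Ω} {f : HMinus2 Ω}

theorem tensorIntegral_fn_eq_sum_hull (𝒯 : Triangulation Ω) (σ τ : Tensor Ω) :
    tensorIntegral Ω σ.fn τ.fn = ∑ T ∈ 𝒯.triangles, tensorIntegral (hull T) σ.fn τ.fn :=
  𝒯.setIntegral_domain (integrableOn_tensor_mul (σ.memLp_fn .rfl) (τ.memLp_fn .rfl))

theorem IsPrimalSolution.goal_eq {ft : L2 Ω} {u ut : H20 Ω} (hu : IsPrimalSolution f u)
    (hut : IsDualSolution ft ut) : goal ft (fnOf u) = f ut := by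
  rw [← hut u, ← hu ut, tensorIntegral_comm]

theorem BrokenPoly.tensorIntegral_sub_hess {k : ℕ} (v : BrokenPoly 𝒯 k) (σ τ τ' : Tensor Ω)
    {T : Finset Plane} (hT : T ∈ 𝒯.triangles) :
    tensorIntegral (hull T) (σ.fn - v.hess T) τ.fn +
        tensorIntegral (hull T) (σ.fn - v.hess T) (τ'.fn - τ.fn) =
      tensorIntegral (hull T) σ.fn τ'.fn - tensorIntegral (hull T) (v.hess T) τ'.fn := by
  have hfn (ρ : Tensor Ω) := ρ.memLp_fn (𝒯.hull_ae_le_domain hT)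
  have hdiff (i j) : MemLp ((σ.fn - v.hess T) i j) 2 (volume.restrict (hull T)) :=
    (hfn σ i j).sub (v.memLp_hess T i j)
  rw [tensorIntegral_sub_right hdiff (hfn τ') (hfn τ), add_sub_cancel,
    tensorIntegral_sub_left (hfn σ) (v.memLp_hess T) (hfn τ')]

theorem estimator_add_remainder (F : EdgeFrame 𝒯) {k : ℕ} (ut : H20 Ω) (uh : BrokenPoly 𝒯 k)
    (st : H20 Ω) (σ σt : Tensor Ω) {S D : EdgeTraces} (hS : S.IsIntegrable 𝒯.edges (uh.jump F))
    (hD : D.IsIntegrable 𝒯.edges (uh.jump F)) :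
    estimator F f uh st σ σt S + remainder F f ut uh st σ σt S D =
      f ut - ∑ T ∈ 𝒯.triangles, tensorIntegral (hull T) (uh.hess T) (D2 ut).fn +
        uh.edgePairing F D := by
  have hvol : (f - divDiv σ) (ut - st) = f ut - f st -
      (∑ T ∈ 𝒯.triangles, tensorIntegral (hull T) σ.fn (D2 ut).fn -
        ∑ T ∈ 𝒯.triangles, tensorIntegral (hull T) σ.fn (D2 st).fn) := by
    simp only [sub_apply, map_sub, divDiv_apply, tensorIntegral_fn_eq_sum_hull 𝒯]
    ring
  have htensor := Finset.sum_congr rfl fun T hT => uh.tensorIntegral_sub_hess σ σt (D2 ut) hT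
  have hedge := uh.edgePairing_sub F hD hS
  simp only [Finset.sum_add_distrib, Finset.sum_sub_distrib] at htensor
  simp only [BrokenPoly.edgePairing, EdgeTraces.nτ_sub, EdgeTraces.nn_sub,
    EdgeTraces.div_sub] at hedge ⊢
  simp only [estimator, remainder, hvol]
  linarith

end GoalBiharmonic

theorem theorem4p1_general {Ω : Set Plane} (𝒯 : Triangulation Ω) (F : EdgeFrame 𝒯) {k : ℕ}
    {f : HMinus2 Ω} {ft : L2 Ω} {u ut : H20 Ω} (hu : IsPrimalSolution f u)
    (hut : IsDualSolution ft ut) (uh : BrokenPoly 𝒯 k) (st : H20 Ω) (σ σt : Tensor Ω)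
    {S D : EdgeTraces} (hS : S.IsIntegrable 𝒯.edges (uh.jump F))
    (hD : HasMomentTrace Ω 𝒯.edges F.n (uh.jump F) (D2 ut).fn D.vec D.div) :
    goal ft (fnOf u) - goal ft uh.toL2 =
      estimator F f uh st σ σt S + remainder F f ut uh st σ σt S D := by
  rw [hu.goal_eq hut, uh.goal_eq_sub_edgePairing F hut hD,
    estimator_add_remainder F ut uh st σ σt hS hD.isIntegrable, sub_sub_eq_add_sub,
    sub_add_eq_add_sub]

theorem theorem4p1 {Ω : Set Plane} (𝒯 : Triangulation Ω) (F : EdgeFrame 𝒯) (k : ℕ)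
    -- the data, the primal and the dual solution
    (f : HMinus2 Ω) (ft : L2 Ω) (u ut : H20 Ω)
    (hu : IsPrimalSolution f u) (hut : IsDualSolution ft ut)
    -- arbitrary piecewise polynomials
    (uh uth : BrokenPoly 𝒯 k)
    -- potential reconstructions
    (s st : H20 Ω) (hs : IsPotentialReconstruction s) (hst : IsPotentialReconstruction st)
    -- equilibrated moment tensors
    (fh fth : HMinus2 Ω) (σ σt : Tensor Ω)
    (hσ : IsEquilibrated fh σ) (hσt : IsEquilibrated fth σt)
    -- the traces of `D²ũ` and `div D²ũ` on the edges
    (D : EdgeTraces)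
    (hD : HasMomentTrace Ω 𝒯.edges F.n (uh.jump F) (D2 ut).fn D.vec D.div)
    -- the traces of `σ̃_h^eq` and `div σ̃_h^eq` on the edges, from inside each triangle
    (t : Finset Plane → EdgeTraces)
    (ht : ∀ T ∈ 𝒯.triangles, HasMomentTrace (interior (hull T)) (𝒯.edgesOf T) F.n (uh.jump F)
      σt.fn (t T).vec (t T).div)
    (w : Finset Plane → ℝ) :
    goal ft (fnOf u) - goal ft uh.toL2 =
      estimator F f uh st σ σt (EdgeTraces.glue F w t) +
        remainder F f ut uh st σ σt (EdgeTraces.glue F w t) D := by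
  exact theorem4p1_general 𝒯 F hu hut uh st σ σt
    (.glue F w fun T hT => (ht T hT).isIntegrable) hD
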